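/- Setting. For each sample size $n$ there are participants $W_i=(Y_i(1),Y_i(0),D_i(0),D_i(1),Z_i)$, $i=1,\dots,n$, with real potential outcomes $Y_i(d)$, binary potential treatment decisions $D_i(a)\in\{0,1\}$ and covariates $Z_i\in\mathcal Z$; $S_i=S(Z_i)$ is the stratum of $i$, where $S:\mathcal Z\to\mathcal S$ is a given (measurable) map into a finite set. $A_i\in\{0,1\}$ is the treatment assignment, $D_i=D_i(1)A_i+D_i(0)(1-A_i)$ the treatment decision and $Y_i=Y_i(1)D_i+Y_i(0)(1-D_i)$ the outcome. Write $W^{(n)},A^{(n)},S^{(n)}$ for the vectors of the $W_i,A_i,S_i$, and $n(s),n_A(s),n_D(s),n_{AD}(s)$ for the numbers of $i$ with $S_i=s$; with $A_i=1,S_i=s$; with $D_i=1,S_i=s$; and with $A_i=D_i=1,S_i=s$. A participant is a complier ($C$) if $D(0)=0,D(1)=1$, an always taker ($AT$) if $D(0)=D(1)=1$, a never taker ($NT$) if $D(0)=D(1)=0$. Let $p(s)=P(S=s)$, $\pi_{D(a)}(s)=P(D(a)=1\mid S=s)$, $P(C)=\sum_s p(s)(\pi_{D(1)}(s)-\pi_{D(0)}(s))$,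 $\beta(s)=E[Y(1)-Y(0)\mid C,S=s]$, $\beta=E[Y(1)-Y(0)\mid C]$ and $$\gamma(s)=\pi_{D(1)}(s)E[Y(0)|C,S=s]-\pi_{D(0)}(s)E[Y(1)|C,S=s]+\pi_{D(0)}(s)E[Y(1)|AT,S=s]+(1-\pi_{D(1)}(s))E[Y(0)|NT,S=s].$$ Assumption 1. $W^{(n)}$ is i.i.d. with a common law $Q$ not depending on $n$, and (a) $E[Y(d)^2]<\infty$ for $d\in\{0,1\}$; (b) $p(s)>0$ for all $s$; (c) $P(D(0)=1,D(1)=0)=0$; (d) $\pi_{D(1)}(s)-\pi_{D(0)}(s)>0$ for all $s$. Assumption 3. (a) $W^{(n)}$ and $A^{(n)}$ are independent given $S^{(n)}$; (b) for some $\tau(s)\in[0,1]$, $\{\sqrt n(n_A(s)/n(s)-\pi_A):s\in\mathcal S\}\mid S^{(n)}$ converges in distribution to $N(0,\mathrm{diag}\{\tau(s)\pi_A(1-\pi_A)/p(s):s\in\mathcal S\})$ with probability approaching one, i.e. there are sets $M_n$ of values of $S^{(n)}$ with $P(S^{(n)}\in M_n)\to1$ such that the conditional laws given $S^{(n)}=s^{(n)}$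 converge weakly to this normal law along every sequence of values $s^{(n)}\in M_n$ of positive probability; (c) $\pi_A\in(0,1)$ does not depend on $s$. Target. In the following, with $\Delta_1(s)=E[Y(1)|C,S=s]-E[Y(1)|AT,S=s]$ and $\Delta_0(s)=E[Y(0)|C,S=s]-E[Y(0)|NT,S=s]$, a conditional moment given an event of probability $0$ occurs only multiplied by $0$, and the product is read as $0$. Let $V_{\mathrm{2s}}=V_{\mathrm{sat}}+V_A^{\mathrm{2s}}$, $V_{\mathrm{sat}}=V_{Y,1}+V_{Y,0}+V_{D,1}+V_{D,0}+V_H$, where $$V_{Y,1}=\tfrac1{P(C)^2}\sum_s\tfrac{p(s)}{\pi_A}\Big[V[Y(1)|AT,s]\pi_{D(0)}(s)+V[Y(0)|NT,s](1-\pi_{D(1)}(s))+V[Y(1)|C,s](\pi_{D(1)}(s)-\pi_{D(0)}(s))+\Delta_1(s)^2\tfrac{\pi_{D(0)}(s)(\pi_{D(1)}(s)-\pi_{D(0)}(s))}{\pi_{D(1)}(s)}\Big],$$ $$V_{Y,0}=\tfrac1{P(C)^2}\sum_s\tfrac{p(s)}{1-\pi_A}\Big[V[Y(1)|AT,s]\pi_{D(0)}(s)+V[Y(0)|NT,s](1-\pi_{D(1)}(s))+V[Y(0)|C,s](\pi_{D(1)}(s)-\pi_{D(0)}(s))+\Delta_0(s)^2\tfrac{(1-\pi_{D(1)}(s))(\pi_{D(1)}(s)-\pi_{D(0)}(s))}{1-\pi_{D(0)}(s)}\Big],$$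 $$V_{D,1}=\tfrac1{P(C)^2}\sum_s\tfrac{p(s)(1-\pi_{D(1)}(s))}{\pi_A\pi_{D(1)}(s)}\big[-\pi_{D(0)}(s)\Delta_1(s)+\pi_{D(1)}(s)\Delta_0(s)+\pi_{D(1)}(s)(\beta(s)-\beta)\big]^2,$$ $$V_{D,0}=\tfrac1{P(C)^2}\sum_s\tfrac{p(s)\pi_{D(0)}(s)}{(1-\pi_A)(1-\pi_{D(0)}(s))}\big[-(1-\pi_{D(0)}(s))\Delta_1(s)+(1-\pi_{D(1)}(s))\Delta_0(s)+(1-\pi_{D(0)}(s))(\beta(s)-\beta)\big]^2,$$ $$V_H=\tfrac1{P(C)^2}\sum_s p(s)(\pi_{D(1)}(s)-\pi_{D(0)}(s))^2(\beta(s)-\beta)^2,$$ $$V_A^{\mathrm{2s}}=\sum_s\tfrac{p(s)\tau(s)}{\pi_A(1-\pi_A)P(C)^2}\Big[(\pi_A\pi_{D(0)}(s)+(1-\pi_A)\pi_{D(1)}(s))(\beta(s)-\beta)+\gamma(s)-\sum_{\tilde s}p(\tilde s)\big\{(\pi_A\pi_{D(1)}(\tilde s)+(1-\pi_A)\pi_{D(0)}(\tilde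 s))(\beta(\tilde s)-\beta)+\gamma(\tilde s)\big\}\Big]^2$$ (here $V[\,\cdot\,|T,s]$ is the conditional variance given type $T$ and $S=s$). Estimators. Let $(\{\hat\gamma_{\mathrm{sat}}(s)\}_s,\{\hat\beta_{\mathrm{sat}}(s)\}_s)=(\mathbf Z'\mathbf X)^{-1}\mathbf Z'\mathbf Y$, where $\mathbf X,\mathbf Z$ have rows $(\{I\{S_i=s\}\}_s,\{D_iI\{S_i=s\}\}_s)$ and $(\{I\{S_i=s\}\}_s,\{A_iI\{S_i=s\}\}_s)$ and $\mathbf Y=(Y_i)$; $\hat u_i=Y_i-\hat\gamma_{\mathrm{sat}}(S_i)-D_i\hat\beta_{\mathrm{sat}}(S_i)$; $\hat f_1(s)=\frac{n_{AD}(s)}{n_A(s)}$, $\hat f_0(s)=\frac{n_D(s)-n_{AD}(s)}{n(s)-n_A(s)}$, $\hat\pi_A(s)=\frac{n_A(s)}{n(s)}$; $\hat P(C)=\sum_s\frac{n(s)}n(\hat f_1(s)-\hat f_0(s))$; $\hat\beta_{\mathrm{sat}}=\frac1{\hat P(C)}\sum_s\frac{n(s)}n(\hat f_1(s)-\hat f_0(s))\hat\beta_{\mathrm{sat}}(s)$;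 $\hat\delta(s)=\hat\beta_{\mathrm{sat}}(s)-\hat\beta_{\mathrm{sat}}$. Put $\hat V_{\mathrm{sat}}=\hat V_1+\hat V_0+\hat V_H$ with $$\hat V_1=\tfrac1{\hat P(C)^2}\sum_s\big(\tfrac{n(s)}{n_A(s)}\big)^2\Big[\tfrac1n\sum_{i:D_i=1,A_i=1,S_i=s}\{\hat u_i+(1-\hat f_1(s))\hat\delta(s)\}^2+\tfrac1n\sum_{i:D_i=0,A_i=1,S_i=s}\{\hat u_i-\hat f_1(s)\hat\delta(s)\}^2\Big],$$ $$\hat V_0=\tfrac1{\hat P(C)^2}\sum_s\big(\tfrac{n(s)}{n(s)-n_A(s)}\big)^2\Big[\tfrac1n\sum_{i:D_i=1,A_i=0,S_i=s}\{\hat u_i+(1-\hat f_0(s))\hat\delta(s)\}^2+\tfrac1n\sum_{i:D_i=0,A_i=0,S_i=s}\{\hat u_i-\hat f_0(s)\hat\delta(s)\}^2\Big],$$ $$\hat V_H=\tfrac1{\hat P(C)^2}\sum_s\tfrac{n(s)}n(\hat f_1(s)-\hat f_0(s))^2\hat\delta(s)^2,$$ and $$\hat V_A^{\mathrm{2s}}=\sum_s\frac{\frac{n(s)}n\tau(s)}{\hat\pi_A(s)(1-\hat\pi_A(s))\hat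 P(C)^2}\Big[\big(\hat\pi_A(s)\hat f_0(s)+(1-\hat\pi_A(s))\hat f_1(s)\big)\hat\delta(s)-\sum_{\tilde s}\tfrac{n_D(\tilde s)}n\hat\delta(\tilde s)+\hat\gamma_{\mathrm{sat}}(s)-\sum_{\tilde s}p(\tilde s)\hat\gamma_{\mathrm{sat}}(\tilde s)\Big]^2.$$ (On the event, of probability tending to $0$, that a denominator vanishes or $\mathbf Z'\mathbf X$ is singular, the quotient or inverse is given the value $0$.) Theorem. Under Assumptions 1 and 3, $\hat V_{\mathrm{2s}}=\hat V_{\mathrm{sat}}+\hat V_A^{\mathrm{2s}}$ converges in probability to $V_{\mathrm{2s}}$ as $n\to\infty$. The same holds when $p(\tilde s)$ in $\hat V_A^{\mathrm{2s}}$ is replaced by the observed frequency $n(\tilde s)/n$. -/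

import Mathlib

open MeasureTheory ProbabilityTheory Filter Topology Matrix
open scoped BoundedContinuousFunction

noncomputable section

/-! ### Participants, the population, and its primitive parameters

The value `1` of a treatment assignment or of a treatment decision is `true`, the value `0`
is `false`. -/

/-- What is attached to one participant before the assignment: the potential outcomes `Y(d)`, the
potential treatment decisions `D(a)`, and the baseline covariates `Z`. -/
abbrev Participant (𝒵 : Type*) := (Bool → ℝ) × (Bool → Bool) × 𝒵

namespace Participant

variable {𝒵 : Type*}

/-- The potential outcome `Y(d)`. -/
def Y (d : Bool) (w : Participant 𝒵) : ℝ := w.1 d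

/-- The potential treatment decision `D(a)`. -/
def D (a : Bool) (w : Participant 𝒵) : Bool := w.2.1 a

/-- The baseline covariates. -/
def Z (w : Participant 𝒵) : 𝒵 := w.2.2

/-- The event that the participant is a complier. -/
def C : Set (Participant 𝒵) := {w | D false w = false ∧ D true w = true}

/-- The event that the participant is an always taker. -/
def AT : Set (Participant 𝒵) := {w | D false w = true ∧ D true w = true}

/-- The event that the participant is a never taker. -/
def NT : Set (Participant 𝒵) := {w | D false w = false ∧ D true w = false}

/-- The event that the participant is a defier. -/
def DEF : Set (Participant 𝒵) := {w | D false w = true ∧ D true w = false}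

end Participant

/-- The event that the participant belongs to stratum `s`, for the stratification map `S`. -/
def inStratum {𝒵 𝒮 : Type*} (S : 𝒵 → 𝒮) (s : 𝒮) : Set (Participant 𝒵) :=
  {w | S w.Z = s}

section Population

variable {𝒵 𝒮 : Type*} [MeasurableSpace 𝒵]

/-- `p(s) = P(S = s)`. -/
def pS (Q : Measure (Participant 𝒵)) (S : 𝒵 → 𝒮) (s : 𝒮) : ℝ := Q.real (inStratum S s)

/-- `π_{D(a)}(s) = P(D(a) = 1 | S = s)`. -/
def piD (Q : Measure (Participant 𝒵)) (S : 𝒵 → 𝒮) (a : Bool) (s : 𝒮) : ℝ :=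
  (Q[|inStratum S s]).real {w | w.D a = true}

/-- `E[Y(d) | T, S = s]` for a type `T` of participants. When `P(T, S = s) = 0` the value is `0`;
below this value then only occurs multiplied by `0`. -/
def condMean (Q : Measure (Participant 𝒵)) (S : 𝒵 → 𝒮) (d : Bool) (T : Set (Participant 𝒵))
    (s : 𝒮) : ℝ :=
  ∫ w, w.Y d ∂(Q[|T ∩ inStratum S s])

/-- `V[Y(d) | T, S = s]` for a type `T` of participants, with the same convention. -/
def condVariance (Q : Measure (Participant 𝒵)) (S : 𝒵 → 𝒮) (d : Bool) (T : Set (Participant 𝒵))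
    (s : 𝒮) : ℝ :=
  variance (fun w : Participant 𝒵 => w.Y d) (Q[|T ∩ inStratum S s])

/-- `E[Y(1) - Y(0) | C, S = s]`. -/
def lateS (Q : Measure (Participant 𝒵)) (S : 𝒵 → 𝒮) (s : 𝒮) : ℝ :=
  ∫ w, (w.Y true - w.Y false) ∂(Q[|Participant.C ∩ inStratum S s])

/-- The local average treatment effect `β = E[Y(1) - Y(0) | C]`. -/
def late (Q : Measure (Participant 𝒵)) : ℝ :=
  ∫ w, (w.Y true - w.Y false) ∂(Q[|Participant.C])

open Participant in
/-- `γ(s)`: the combination of conditional means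
`π_{D(1)} E[Y(0)|C] - π_{D(0)} E[Y(1)|C] + π_{D(0)} E[Y(1)|AT] + (1 - π_{D(1)}) E[Y(0)|NT]`,
all of them given `S = s`. -/
def gammaS (Q : Measure (Participant 𝒵)) (S : 𝒵 → 𝒮) (s : 𝒮) : ℝ :=
  piD Q S true s * condMean Q S false C s - piD Q S false s * condMean Q S true C s
    + piD Q S false s * condMean Q S true AT s
    + (1 - piD Q S true s) * condMean Q S false NT s

variable [Fintype 𝒮]

/-- `P(C) = ∑ₛ p(s) (π_{D(1)}(s) - π_{D(0)}(s))`. -/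
def probC (Q : Measure (Participant 𝒵)) (S : 𝒵 → 𝒮) : ℝ :=
  ∑ s, pS Q S s * (piD Q S true s - piD Q S false s)

/-! ### The asymptotic variances -/

open Participant in
def VsatY1 (Q : Measure (Participant 𝒵)) (S : 𝒵 → 𝒮) (piA : 𝒮 → ℝ) : ℝ :=
  1 / probC Q S ^ 2 * ∑ s, pS Q S s / piA s *
    (condVariance Q S true AT s * piD Q S false s
      + condVariance Q S false NT s * (1 - piD Q S true s)
      + condVariance Q S true C s * (piD Q S true s - piD Q S false s)
      + (condMean Q S true C s - condMean Q S true AT s) ^ 2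
        * (piD Q S false s * (piD Q S true s - piD Q S false s) / piD Q S true s))

open Participant in
def VsatY0 (Q : Measure (Participant 𝒵)) (S : 𝒵 → 𝒮) (piA : 𝒮 → ℝ) : ℝ :=
  1 / probC Q S ^ 2 * ∑ s, pS Q S s / (1 - piA s) *
    (condVariance Q S true AT s * piD Q S false s
      + condVariance Q S false NT s * (1 - piD Q S true s)
      + condVariance Q S false C s * (piD Q S true s - piD Q S false s)
      + (condMean Q S false C s - condMean Q S false NT s) ^ 2
        * ((1 - piD Q S true s) * (piD Q S true s - piD Q S false s) / (1 - piD Q S false s)))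

open Participant in
def VsatD1 (Q : Measure (Participant 𝒵)) (S : 𝒵 → 𝒮) (piA : 𝒮 → ℝ) : ℝ :=
  1 / probC Q S ^ 2 * ∑ s, pS Q S s * (1 - piD Q S true s) / (piA s * piD Q S true s) *
    (-piD Q S false s * (condMean Q S true C s - condMean Q S true AT s)
      + piD Q S true s * (condMean Q S false C s - condMean Q S false NT s)
      + piD Q S true s * (lateS Q S s - late Q)) ^ 2

open Participant in
def VsatD0 (Q : Measure (Participant 𝒵)) (S : 𝒵 → 𝒮) (piA : 𝒮 → ℝ) : ℝ :=
  1 / probC Q S ^ 2 * ∑ s, pS Q S s * piD Q S false s / ((1 - piA s) * (1 - piD Q S false s)) *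
    (-(1 - piD Q S false s) * (condMean Q S true C s - condMean Q S true AT s)
      + (1 - piD Q S true s) * (condMean Q S false C s - condMean Q S false NT s)
      + (1 - piD Q S false s) * (lateS Q S s - late Q)) ^ 2

def VsatH (Q : Measure (Participant 𝒵)) (S : 𝒵 → 𝒮) : ℝ :=
  1 / probC Q S ^ 2 *
    ∑ s, pS Q S s * (piD Q S true s - piD Q S false s) ^ 2 * (lateS Q S s - late Q) ^ 2

/-- The asymptotic variance `V_sat` of the SAT estimator. -/
def Vsat (Q : Measure (Participant 𝒵)) (S : 𝒵 → 𝒮) (piA : 𝒮 → ℝ) : ℝ :=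
  VsatY1 Q S piA + VsatY0 Q S piA + VsatD1 Q S piA + VsatD0 Q S piA + VsatH Q S

/-- `V_A^{2s}`, for a target assignment proportion `piA` common to all strata. -/
def VA2s (Q : Measure (Participant 𝒵)) (S : 𝒵 → 𝒮) (piA : ℝ) (tau : 𝒮 → ℝ) : ℝ :=
  ∑ s, pS Q S s * tau s / (piA * (1 - piA) * probC Q S ^ 2) *
    ((piA * piD Q S false s + (1 - piA) * piD Q S true s) * (lateS Q S s - late Q)
      + gammaS Q S s
      - ∑ t, pS Q S t *
          ((piA * piD Q S true t + (1 - piA) * piD Q S false t) * (lateS Q S t - late Q)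
            + gammaS Q S t)) ^ 2

/-- The asymptotic variance `V_{2s} = V_sat + V_A^{2s}` of the two-sample estimator. -/
def V2s (Q : Measure (Participant 𝒵)) (S : 𝒵 → 𝒮) (piA : ℝ) (tau : 𝒮 → ℝ) : ℝ :=
  Vsat Q S (fun _ => piA) + VA2s Q S piA tau

end Population

/-! ### The observed data and the estimators -/

/-- The data used by the estimators: outcomes, treatment decisions, assignments and strata. -/
structure ObsData (n : ℕ) (𝒮 : Type*) where
  Y : Fin n → ℝ
  D : Fin n → Bool
  A : Fin n → Bool
  S : Fin n → 𝒮

/-- The observed data generated by `n` participants `w` under the assignment `a`: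
`D_i = D_i(A_i)`, `Y_i = Y_i(D_i)` and `S_i = S(Z_i)`. -/
def observe {𝒵 𝒮 : Type*} {n : ℕ} (S : 𝒵 → 𝒮) (w : Fin n → Participant 𝒵) (a : Fin n → Bool) :
    ObsData n 𝒮 where
  Y i := (w i).Y ((w i).D (a i))
  D i := (w i).D (a i)
  A := a
  S i := S (w i).Z

/-- `0` or `1` as a real number. -/
def bit (b : Bool) : ℝ := if b then 1 else 0

namespace ObsData

variable {n : ℕ} {𝒮 : Type*} [DecidableEq 𝒮]

/-- `n(s)`. -/
def nS (x : ObsData n 𝒮) (s : 𝒮) : ℝ := ∑ i, if x.S i = s then 1 else 0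

/-- `n_A(s)`. -/
def nA (x : ObsData n 𝒮) (s : 𝒮) : ℝ := ∑ i, if x.A i = true ∧ x.S i = s then 1 else 0

/-- `n_D(s)`. -/
def nD (x : ObsData n 𝒮) (s : 𝒮) : ℝ := ∑ i, if x.D i = true ∧ x.S i = s then 1 else 0

/-- `n_{AD}(s)`. -/
def nAD (x : ObsData n 𝒮) (s : 𝒮) : ℝ :=
  ∑ i, if x.A i = true ∧ x.D i = true ∧ x.S i = s then 1 else 0

/-- `n_{AD}(s) / n_A(s)`, the frequency of treated among the assigned to treatment. -/
def freqD1 (x : ObsData n 𝒮) (s : 𝒮) : ℝ := x.nAD s / x.nA s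

/-- `(n_D(s) - n_{AD}(s)) / (n(s) - n_A(s))`, the frequency of treated among the assigned to
control. -/
def freqD0 (x : ObsData n 𝒮) (s : 𝒮) : ℝ := (x.nD s - x.nAD s) / (x.nS s - x.nA s)

/-- The regressor matrix of the SAT regression, with rows
`({I{S_i = s}}_s, {D_i I{S_i = s}}_s)`. -/
def Xsat (x : ObsData n 𝒮) : Matrix (Fin n) (𝒮 ⊕ 𝒮) ℝ :=
  Matrix.of fun i => Sum.elim (fun s => if x.S i = s then 1 else 0)
    (fun s => bit (x.D i) * if x.S i = s then 1 else 0)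

/-- The instrument matrix of the SAT regression, with rows
`({I{S_i = s}}_s, {A_i I{S_i = s}}_s)`. -/
def Zsat (x : ObsData n 𝒮) : Matrix (Fin n) (𝒮 ⊕ 𝒮) ℝ :=
  Matrix.of fun i => Sum.elim (fun s => if x.S i = s then 1 else 0)
    (fun s => bit (x.A i) * if x.S i = s then 1 else 0)

variable [Fintype 𝒮]

/-- The SAT IV coefficients `(Z'X)⁻¹ (Z'Y)`. -/
def satCoef (x : ObsData n 𝒮) : 𝒮 ⊕ 𝒮 → ℝ :=
  (x.Zsatᵀ * x.Xsat)⁻¹ *ᵥ (x.Zsatᵀ *ᵥ x.Y)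

def gammaSat (x : ObsData n 𝒮) (s : 𝒮) : ℝ := x.satCoef (Sum.inl s)

def betaSat (x : ObsData n 𝒮) (s : 𝒮) : ℝ := x.satCoef (Sum.inr s)

/-- The estimator of `P(S = s, C)`. -/
def PhatSC (x : ObsData n 𝒮) (s : 𝒮) : ℝ := x.nS s / n * (x.freqD1 s - x.freqD0 s)

/-- The estimator of `P(C)`. -/
def PhatC (x : ObsData n 𝒮) : ℝ := ∑ s, x.nS s / n * (x.freqD1 s - x.freqD0 s)

/-- The SAT estimator of the LATE. -/
def betaSatLate (x : ObsData n 𝒮) : ℝ := ∑ s, x.PhatSC s / x.PhatC * x.betaSat s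

/-- The SAT IV residuals. -/
def resid (x : ObsData n 𝒮) (i : Fin n) : ℝ :=
  x.Y i - ∑ s, (if x.S i = s then 1 else 0) * x.gammaSat s
    - ∑ s, (bit (x.D i) * if x.S i = s then 1 else 0) * x.betaSat s

/-- `(1/n) ∑ᵢ I{D_i = d, A_i = a, S_i = s} (û_i + c)²`. -/
def cellSq (x : ObsData n 𝒮) (d a : Bool) (s : 𝒮) (c : ℝ) : ℝ :=
  1 / n * ∑ i, (if x.D i = d ∧ x.A i = a ∧ x.S i = s then 1 else 0) * (x.resid i + c) ^ 2

def Vhat1 (x : ObsData n 𝒮) : ℝ :=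
  1 / x.PhatC ^ 2 * ∑ s, (x.nS s / x.nA s) ^ 2 *
    (x.cellSq true true s ((1 - x.freqD1 s) * (x.betaSat s - x.betaSatLate))
      + x.cellSq false true s (-(x.freqD1 s * (x.betaSat s - x.betaSatLate))))

def Vhat0 (x : ObsData n 𝒮) : ℝ :=
  1 / x.PhatC ^ 2 * ∑ s, (x.nS s / (x.nS s - x.nA s)) ^ 2 *
    (x.cellSq true false s ((1 - x.freqD0 s) * (x.betaSat s - x.betaSatLate))
      + x.cellSq false false s (-(x.freqD0 s * (x.betaSat s - x.betaSatLate))))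

def VhatH (x : ObsData n 𝒮) : ℝ :=
  1 / x.PhatC ^ 2 *
    ∑ s, x.nS s / n * (x.freqD1 s - x.freqD0 s) ^ 2 * (x.betaSat s - x.betaSatLate) ^ 2

/-- The estimator of `V_sat`. -/
def VhatSat (x : ObsData n 𝒮) : ℝ := x.Vhat1 + x.Vhat0 + x.VhatH

/-- The estimator of `V_A^{2s}`; `q` are the stratum weights in the average of the
coefficients `γ̂_sat`. -/
def VhatA2s (x : ObsData n 𝒮) (tau q : 𝒮 → ℝ) : ℝ :=
  ∑ s, x.nS s / n * tau s / (x.nA s / x.nS s * (1 - x.nA s / x.nS s) * x.PhatC ^ 2) *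
    ((x.nA s / x.nS s * x.freqD0 s + (1 - x.nA s / x.nS s) * x.freqD1 s)
          * (x.betaSat s - x.betaSatLate)
      - ∑ t, x.nD t / n * (x.betaSat t - x.betaSatLate)
      + x.gammaSat s - ∑ t, q t * x.gammaSat t) ^ 2

/-- The estimator `V̂_{2s} = V̂_sat + V̂_A^{2s}`. -/
def Vhat2s (x : ObsData n 𝒮) (tau q : 𝒮 → ℝ) : ℝ := x.VhatSat + x.VhatA2s tau q

end ObsData

/-! ### Modes of convergence along a sequence of probability spaces -/

section Convergence

variable {Ω : ℕ → Type*} [∀ n, MeasurableSpace (Ω n)]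

/-- Convergence in probability of `X n` (defined on the `n`-th probability space) to `c`. -/
def TendstoInProb (μ : ∀ n, Measure (Ω n)) (X : ∀ n, Ω n → ℝ) (c : ℝ) : Prop :=
  ∀ ε > 0, Tendsto (fun n => μ n {ω | ε ≤ |X n ω - c|}) atTop (𝓝 0)

/-- `{X n | T n}` converges in distribution to `ν` with probability approaching one, for discrete
`T n`: there are sets `M n` of values of `T n` with `P(T n ∈ M n) → 1` such that, along every
sequence of (non-null) values `t n ∈ M n`, the law of `X n` given `T n = t n` converges weakly
to `ν`. -/
def CondTendstoInLawWpa1 {𝒯 : ℕ → Type*} {E : Type*} [TopologicalSpace E] [MeasurableSpace E]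
    (μ : ∀ n, Measure (Ω n)) (T : ∀ n, Ω n → 𝒯 n) (X : ∀ n, Ω n → E) (ν : Measure E) : Prop :=
  ∃ M : ∀ n, Set (𝒯 n),
    Tendsto (fun n => μ n (T n ⁻¹' M n)) atTop (𝓝 1) ∧
    ∀ t : ∀ n, 𝒯 n, (∀ᶠ n in atTop, t n ∈ M n ∧ μ n (T n ⁻¹' {t n}) ≠ 0) →
      ∀ f : E →ᵇ ℝ,
        Tendsto (fun n => ∫ ω, f (X n ω) ∂((μ n)[|T n ⁻¹' {t n}])) atTop (𝓝 (∫ e, f e ∂ν))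

end Convergence

/-! ### The assumptions -/

section Assumptions

variable {𝒵 𝒮 : Type*} [MeasurableSpace 𝒵]

/-- The restrictions on the sampling of the participants: for every `n`, `W n` is an i.i.d. sample
of size `n` from `Q`, and `Q` satisfies (a)-(d). -/
structure SamplingAssumption {Ω : ℕ → Type*} [∀ n, MeasurableSpace (Ω n)]
    (μ : ∀ n, Measure (Ω n)) (W : ∀ n, Ω n → Fin n → Participant 𝒵)
    (Q : Measure (Participant 𝒵)) (S : 𝒵 → 𝒮) : Prop where
  measurable_sample : ∀ n, Measurable (W n)
  iid : ∀ n, (μ n).map (W n) = Measure.pi (fun _ : Fin n => Q)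
  sq_integrable : ∀ d, MemLp (fun w : Participant 𝒵 => w.Y d) 2 Q
  strata_pos : ∀ s, 0 < pS Q S s
  no_defiers : Q Participant.DEF = 0
  compliers : ∀ s, 0 < piD Q S true s - piD Q S false s

/-- The strata of the sampled participants. -/
def strata {Ω : Type*} {n : ℕ} (S : 𝒵 → 𝒮) (W : Ω → Fin n → Participant 𝒵) (ω : Ω) :
    Fin n → 𝒮 :=
  fun i => S (W ω i).Z

/-- The restrictions on the treatment assignment mechanism `A`: (a) given the strata, the
assignment is independent of the participants (the strata are discrete, so conditioning on them is
elementary); (b) given the strata, the vector of `√n (n_A(s)/n(s) - π_A)` is asymptotically centred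
normal, with diagonal covariance matrix with entries `τ(s) π_A (1 - π_A) / p(s)`, with probability
approaching one; (c) the target proportion `π_A ∈ (0,1)` is the same in all strata. -/
structure AssignmentAssumption [Fintype 𝒮] [DecidableEq 𝒮]
    {Ω : ℕ → Type*} [∀ n, MeasurableSpace (Ω n)]
    (μ : ∀ n, Measure (Ω n)) (W : ∀ n, Ω n → Fin n → Participant 𝒵)
    (A : ∀ n, Ω n → Fin n → Bool)
    (Q : Measure (Participant 𝒵)) (S : 𝒵 → 𝒮) (piA : ℝ) (tau : 𝒮 → ℝ) : Prop where
  measurable_assignment : ∀ n, Measurable (A n)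
  cond_indep : ∀ n (t : Fin n → 𝒮),
    IndepFun (W n) (A n) ((μ n)[|strata S (W n) ⁻¹' {t}])
  tau_mem : ∀ s, tau s ∈ Set.Icc (0 : ℝ) 1
  balance : CondTendstoInLawWpa1 μ (fun n => strata S (W n))
    (fun n ω s =>
      √(n : ℝ) * ((observe S (W n ω) (A n ω)).nA s / (observe S (W n ω) (A n ω)).nS s - piA))
    (Measure.pi fun s => gaussianReal 0 (Real.toNNReal (tau s * piA * (1 - piA) / pS Q S s)))
  target_mem : piA ∈ Set.Ioo (0 : ℝ) 1

end Assumptions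

end

/-! The estimator is a fixed rational function of finitely many cell averages `(1/n) ∑ I{D = d, A =
a, S = s} Y^k`, `k ≤ 2`, and of the stratum weights. It is therefore enough to find the limits in
probability of the cell averages, to check that no denominator vanishes in the limit, and to
recognise the value of the function at the limit.

Limits. On the cell `D = d, A = a` the outcome is the potential outcome `Y(d)` and the decision is
`D(a)`, so a cell average is an average of `g(W_i) I{A_i = a}` with `g = Y(d)^k I{D(a) = d}`. The
assignments may depend on each other arbitrarily. However, once `g` is centred at its mean in the
stratum, the terms become orthogonal: given the strata the participants are independent, and
independent of `A`. For bounded `g` Chebyshev's inequality suffices. In general `g` is only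
integrable, and it is approximated in `L¹` by simple functions (`tendsto_average_centered`). What
remains is the stratum mean times the share of the arm, that is `n(s)/n`, which obeys the ordinary
law of large numbers, times `n_A(s)/n(s)` or its complement; the ratio tends to `π_A` because its
deviation scaled by `√n` is tight (`tendsto_cellMoment`).

Value. The matrix `Z'X` decouples into one 2 × 2 system per stratum, with a limiting determinant
that is positive because compliers exist. The mean outcome in arm `a` is `γ(s) + π_{D(a)}(s) β(s)`
(`armMoment_one_add`), so the IV coefficients tend to `γ(s)` and `β(s)`. The limit of the part of
`V̂_sat` from arm `a` is a second moment of a residual that has mean zero in the arm. Splitting its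
variance by treatment decision, and then within a decision by type, produces `V_{Y,a} + V_{D,a}`
(`treated_arm_variance_identity`, `control_arm_variance_identity`).

Convergence in probability is encoded as convergence along the filter `probFilter`. Sums, products
and quotients of limits are then those of ordinary calculus, and conventions for zero denominators
disappear into "eventually". -/

noncomputable section

/-! ### Convergence in probability as convergence along a filter -/

section ProbFilter

variable {Ω : ℕ → Type*} [∀ n, MeasurableSpace (Ω n)]

/-- The filter of the events (along a sequence of probability spaces) whose complements have
vanishing probability. -/
def probFilter (μ : ∀ n, Measure (Ω n)) : Filter (Σ n, Ω n) where
  sets := {E | Tendsto (fun n => μ n {ω | (⟨n, ω⟩ : Σ n, Ω n) ∉ E}) atTop (𝓝 0)}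
  univ_sets := by simp
  sets_of_superset {E F} hE hEF :=
    tendsto_of_tendsto_of_tendsto_of_le_of_le tendsto_const_nhds hE (fun _ => zero_le)
      (fun n => measure_mono fun ω (hω : _ ∉ F) h => hω (hEF h))
  inter_sets {E F} hE hF := by
    have h := Tendsto.add hE hF
    rw [add_zero] at h
    refine tendsto_of_tendsto_of_tendsto_of_le_of_le tendsto_const_nhds h (fun _ => zero_le)
      (fun n => (measure_mono ?_).trans (measure_union_le _ _))
    intro ω hω
    by_contra hc
    simp only [Set.mem_union, Set.mem_ofPred_eq, not_or, not_not] at hc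
    exact hω ⟨hc.1, hc.2⟩

theorem eventually_probFilter {μ : ∀ n, Measure (Ω n)} {p : (Σ n, Ω n) → Prop} :
    (∀ᶠ x in probFilter μ, p x) ↔
      Tendsto (fun n => μ n {ω | ¬ p ⟨n, ω⟩}) atTop (𝓝 0) :=
  Iff.rfl

/-- This replaces Slutsky and continuous mapping arguments by the algebra of `Tendsto`. -/
theorem tendstoInProb_iff {μ : ∀ n, Measure (Ω n)} {X : ∀ n, Ω n → ℝ} {c : ℝ} :
    TendstoInProb μ X c ↔ Tendsto (fun x : Σ n, Ω n => X x.1 x.2) (probFilter μ) (𝓝 c) := by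
  rw [Metric.tendsto_nhds]
  refine forall₂_congr fun ε _ => ?_
  rw [eventually_probFilter]
  simp [Real.dist_eq]

theorem eventually_probFilter_of_atTop {μ : ∀ n, Measure (Ω n)} {p : ℕ → Prop}
    (h : ∀ᶠ n in atTop, p n) : ∀ᶠ x in probFilter μ, p x.1 := by
  rw [eventually_probFilter]
  refine tendsto_const_nhds.congr' ?_
  filter_upwards [h] with n hn
  simp [hn]

theorem tendsto_probFilter_of_real_le {μ : ∀ n, Measure (Ω n)} [∀ n, IsFiniteMeasure (μ n)]
    {X : ∀ n, Ω n → ℝ}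
    (h : ∀ ε > 0, ∀ η > 0, ∀ᶠ n in atTop, (μ n).real {ω | ε ≤ |X n ω|} ≤ η) :
    Tendsto (fun x : Σ n, Ω n => X x.1 x.2) (probFilter μ) (𝓝 0) := by
  rw [← tendstoInProb_iff]
  intro ε hε
  simp only [sub_zero]
  rw [← ENNReal.tendsto_toReal_iff (fun n => measure_ne_top _ _) (by simp)]
  rw [Metric.tendsto_nhds]
  intro η hη
  filter_upwards [h ε hε (η / 2) (by positivity)] with n hn
  rw [ENNReal.toReal_zero, Real.dist_eq, sub_zero, abs_of_nonneg ENNReal.toReal_nonneg]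
  exact lt_of_le_of_lt hn (by linarith)

end ProbFilter

/-! ### Averages of bounded orthogonal variables -/

/-- Chebyshev's inequality. Expanding the square, orthogonality leaves only the `n` diagonal terms,
each at most `K ^ 2`; no independence is needed, which is what allows dependent assignments. -/
theorem real_le_abs_average_le {Ω : Type*} [MeasurableSpace Ω] {μ : Measure Ω}
    [IsProbabilityMeasure μ] {n : ℕ} {X : Fin n → Ω → ℝ} (hX : ∀ i, Measurable (X i)) {K : ℝ}
    (hK : ∀ i ω, |X i ω| ≤ K) (h0 : ∀ i j, i ≠ j → ∫ ω, X i ω * X j ω ∂μ = 0)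
    {ε : ℝ} (hε : 0 < ε) :
    μ.real {ω | ε ≤ |1 / (n : ℝ) * ∑ i, X i ω|} ≤ K ^ 2 / (n * ε ^ 2) := by
  rcases Nat.eq_zero_or_pos n with rfl | hn
  · simp [hε.not_ge]
  have hn' : (0 : ℝ) < n := by exact_mod_cast hn
  have hint : ∀ i j, Integrable (fun ω => X i ω * X j ω) μ := fun i j =>
    Integrable.of_bound ((hX i).mul (hX j)).aestronglyMeasurable (K * K)
      (ae_of_all _ fun ω => by
        rw [Real.norm_eq_abs, abs_mul]
        exact mul_le_mul (hK i ω) (hK j ω) (abs_nonneg _) ((abs_nonneg _).trans (hK i ω)))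
  have hsq : ∀ ω, (∑ i, X i ω) ^ 2 = ∑ i, ∑ j, X i ω * X j ω := fun ω => by
    rw [sq, Finset.sum_mul_sum]
  have hbound : ∫ ω, (∑ i, X i ω) ^ 2 ∂μ ≤ n * K ^ 2 := by
    simp_rw [hsq]
    rw [integral_finsetSum _ fun i _ => integrable_finsetSum _ fun j _ => hint i j]
    have hi : ∀ i, ∫ ω, ∑ j, X i ω * X j ω ∂μ ≤ K ^ 2 := fun i => by
      rw [integral_finsetSum _ fun j _ => hint i j,
        Finset.sum_eq_single i (fun j _ hj => h0 i j hj.symm) (by simp)]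
      calc ∫ ω, X i ω * X i ω ∂μ ≤ ∫ _, K ^ 2 ∂μ :=
            integral_mono (hint i i) (integrable_const _) fun ω => by
              have := sq_le_sq' (by linarith [neg_abs_le (X i ω), hK i ω])
                ((le_abs_self _).trans (hK i ω))
              simpa [sq] using this
        _ = K ^ 2 := by simp
    calc _ ≤ ∑ _i : Fin n, K ^ 2 := Finset.sum_le_sum fun i _ => hi i
      _ = n * K ^ 2 := by simp
  have hmarkov := mul_meas_ge_le_integral_of_nonneg (μ := μ)
    (f := fun ω => (∑ i, X i ω) ^ 2) (ae_of_all _ fun ω => sq_nonneg _)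
    (by simp_rw [hsq]; exact integrable_finsetSum _ fun i _ => integrable_finsetSum _ fun j _ =>
          hint i j) ((n * ε) ^ 2)
  have hset : {ω | ε ≤ |1 / (n : ℝ) * ∑ i, X i ω|} ⊆
      {ω | (n * ε) ^ 2 ≤ (∑ i, X i ω) ^ 2} := fun ω (hω : ε ≤ _) => by
    rw [abs_mul, abs_of_pos (by positivity : 0 < 1 / (n : ℝ)), one_div_mul_eq_div,
      le_div_iff₀ hn'] at hω
    rw [Set.mem_ofPred_eq, ← sq_abs (∑ i, X i ω)]
    exact pow_le_pow_left₀ (by positivity) (by linarith) 2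
  have hreal := measureReal_mono (μ := μ) hset
  rw [le_div_iff₀ (by positivity)]
  have h1 := (mul_le_mul_of_nonneg_left hreal (sq_nonneg (n * ε))).trans (hmarkov.trans hbound)
  nlinarith

/-! ### Elementary conditioning -/

/-- For a null `B` both sides vanish, so the convention that a conditional mean given a null event
is read as multiplied by zero needs no separate treatment. -/
theorem setIntegral_eq_real_mul_integral_cond {Ω : Type*} [MeasurableSpace Ω] {μ : Measure Ω}
    [IsFiniteMeasure μ] (B : Set Ω) (f : Ω → ℝ) :
    ∫ ω in B, f ω ∂μ = μ.real B * ∫ ω, f ω ∂μ[|B] := by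
  rw [ProbabilityTheory.cond, integral_smul_measure, smul_eq_mul, ENNReal.toReal_inv,
    ← measureReal_def]
  by_cases h : μ.real B = 0
  · rw [h, zero_mul]
    exact setIntegral_measure_zero _ ((measureReal_eq_zero_iff).1 h)
  · rw [mul_inv_cancel_left₀ h]

theorem integral_eq_zero_of_fibers {Ω 𝒯 : Type*} [MeasurableSpace Ω] {μ : Measure Ω}
    [Finite 𝒯] (T : Ω → 𝒯) (hT : ∀ t, MeasurableSet (T ⁻¹' {t})) {f : Ω → ℝ}
    (hf : Integrable f μ) (h : ∀ t, ∫ ω in T ⁻¹' {t}, f ω ∂μ = 0) : ∫ ω, f ω ∂μ = 0 := by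
  have := Fintype.ofFinite 𝒯
  have hU : (⋃ t, T ⁻¹' {t}) = Set.univ := by
    ext ω
    simp
  rw [← setIntegral_univ, ← hU, integral_iUnion_fintype hT
    (fun s t hst => Disjoint.preimage T (by simpa using hst)) fun t => hf.integrableOn]
  exact Finset.sum_eq_zero fun t _ => h t

theorem integral_prod_of_map_eq_pi {Ω E : Type*} [MeasurableSpace Ω] [MeasurableSpace E]
    {μ : Measure Ω} {Q : Measure E} [IsProbabilityMeasure Q] {n : ℕ} {W : Ω → Fin n → E}
    (hW : Measurable W) (hlaw : μ.map W = Measure.pi fun _ => Q) {φ : Fin n → E → ℝ}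
    (hφ : ∀ k, Measurable (φ k)) :
    ∫ ω, ∏ k, φ k (W ω k) ∂μ = ∏ k, ∫ w, φ k w ∂Q := by
  rw [← integral_fintype_prod_eq_prod, ← hlaw, integral_map hW.aemeasurable]
  exact (Finset.measurable_fun_prod _ fun k _ => (hφ k).comp (measurable_pi_apply k)).aestronglyMeasurable

theorem map_eval_of_map_eq_pi {Ω E : Type*} [MeasurableSpace Ω] [MeasurableSpace E]
    {μ : Measure Ω} {Q : Measure E} [IsProbabilityMeasure Q] {n : ℕ} {W : Ω → Fin n → E}
    (hW : Measurable W) (hlaw : μ.map W = Measure.pi fun _ => Q) (i : Fin n) :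
    μ.map (fun ω => W ω i) = Q := by
  have := (measurePreserving_eval (fun _ : Fin n => Q) i).map_eq
  rw [← hlaw, Measure.map_map (measurable_pi_apply i) hW] at this
  exact this

/-! ### Laws of large numbers for the sample -/

section Sample

variable {𝒵 𝒮 : Type*} [MeasurableSpace 𝒵]

theorem measurable_stratum [MeasurableSpace 𝒮] {S : 𝒵 → 𝒮} (hS : Measurable S) :
    Measurable fun w : Participant 𝒵 => S w.Z :=
  hS.comp (measurable_snd.comp measurable_snd)

theorem measurableSet_inStratum [MeasurableSpace 𝒮] [MeasurableSingletonClass 𝒮] {S : 𝒵 → 𝒮}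
    (hS : Measurable S) (s : 𝒮) : MeasurableSet (inStratum S s) :=
  measurable_stratum hS (measurableSet_singleton s)

theorem measurable_strata [MeasurableSpace 𝒮] {S : 𝒵 → 𝒮} (hS : Measurable S)
    {Ω : Type*} [MeasurableSpace Ω] {n : ℕ} {W : Ω → Fin n → Participant 𝒵} (hW : Measurable W) :
    Measurable (strata S W) :=
  measurable_pi_lambda _ fun i => (measurable_stratum hS).comp ((measurable_pi_apply i).comp hW)

theorem measurableSet_strata [Finite 𝒮] [MeasurableSpace 𝒮] [MeasurableSingletonClass 𝒮]
    {S : 𝒵 → 𝒮} (hS : Measurable S) {Ω : Type*} [MeasurableSpace Ω] {n : ℕ}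
    {W : Ω → Fin n → Participant 𝒵} (hW : Measurable W) (t : Fin n → 𝒮) :
    MeasurableSet (strata S W ⁻¹' {t}) :=
  measurable_strata hS hW (measurableSet_singleton t)

/-- Given the strata, functions of two participants with conditional mean zero in every stratum
are uncorrelated, also after multiplication by functions of the assignment. -/
theorem integral_mul_eq_zero_of_cond_indep [Finite 𝒮] [MeasurableSpace 𝒮]
    [MeasurableSingletonClass 𝒮] {S : 𝒵 → 𝒮} (hS : Measurable S) {Q : Measure (Participant 𝒵)}
    [IsProbabilityMeasure Q] {Ω : Type*} [MeasurableSpace Ω] {μ : Measure Ω}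
    [IsProbabilityMeasure μ] {n : ℕ} {W : Ω → Fin n → Participant 𝒵} {A : Ω → Fin n → Bool}
    (hW : Measurable W) (hlaw : μ.map W = Measure.pi fun _ => Q) (hA : Measurable A)
    (hind : ∀ t : Fin n → 𝒮, IndepFun W A μ[|strata S W ⁻¹' {t}])
    {c : Participant 𝒵 → ℝ} (hc : Measurable c) {K : ℝ} (hK : ∀ w, |c w| ≤ K)
    (h0 : ∀ s, ∫ w in inStratum S s, c w ∂Q = 0) {b : Bool → ℝ} {i j : Fin n} (hij : i ≠ j) :
    ∫ ω, (c (W ω i) * b (A ω i)) * (c (W ω j) * b (A ω j)) ∂μ = 0 := by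
  have hWi : ∀ i, Measurable fun ω => W ω i := fun i => (measurable_pi_apply i).comp hW
  have hAi : ∀ i, Measurable fun ω => A ω i := fun i => (measurable_pi_apply i).comp hA
  have hb : Measurable b := measurable_of_finite b
  obtain ⟨B, hB⟩ : ∃ B, ∀ a, |b a| ≤ B :=
    ⟨max |b true| |b false|, fun a => by cases a <;> simp⟩
  have hbd : ∀ ω k, |c (W ω k) * b (A ω k)| ≤ K * B := fun ω k => by
    rw [abs_mul]
    exact mul_le_mul (hK _) (hB _) (abs_nonneg _) ((abs_nonneg _).trans (hK (W ω k)))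
  have hm : ∀ k, Measurable fun ω => c (W ω k) * b (A ω k) := fun k =>
    (hc.comp (hWi k)).mul (hb.comp (hAi k))
  refine integral_eq_zero_of_fibers (strata S W) (measurableSet_strata hS hW)
    (Integrable.of_bound ((hm i).mul (hm j)).aestronglyMeasurable ((K * B) * (K * B))
      (ae_of_all _ fun ω => ?_)) fun t => ?_
  · rw [Real.norm_eq_abs, abs_mul]
    exact mul_le_mul (hbd ω i) (hbd ω j) (abs_nonneg _) ((abs_nonneg _).trans (hbd ω i))
  have hind' : IndepFun (fun ω => c (W ω i) * c (W ω j)) (fun ω => b (A ω i) * b (A ω j))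
      μ[|strata S W ⁻¹' {t}] :=
    (hind t).comp (φ := fun w : Fin n → Participant 𝒵 => c (w i) * c (w j))
      (ψ := fun a : Fin n → Bool => b (a i) * b (a j)) (by fun_prop) (by fun_prop)
  -- The event that the strata equal `t` is an intersection of one event per participant, so the
  -- integral factors over participants. The factor of participant `i` is the integral of `c` over
  -- the stratum `t i`, which is zero by `h0`.
  have hzero : ∫ ω in strata S W ⁻¹' {t}, c (W ω i) * c (W ω j) ∂μ = 0 := by
    classical
    rw [← integral_indicator (measurableSet_strata hS hW t)]
    have hprod := integral_prod_of_map_eq_pi hW hlaw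
      (φ := fun k => (inStratum S (t k)).indicator fun w => if k = i ∨ k = j then c w else 1)
      (fun k => Measurable.indicator (by split_ifs <;> fun_prop) (measurableSet_inStratum hS _))
    rw [Finset.prod_eq_zero (i := i) (Finset.mem_univ i)] at hprod
    · rw [← hprod]
      refine integral_congr_ae (ae_of_all _ fun ω => ?_)
      by_cases hω : ω ∈ strata S W ⁻¹' {t}
      · have hk : ∀ k, W ω k ∈ inStratum S (t k) := fun k => congrFun hω k
        simp only [Set.indicator_of_mem hω, Set.indicator_of_mem (hk _)]
        rw [← Finset.mul_prod_erase _ _ (Finset.mem_univ i),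
          ← Finset.mul_prod_erase _ _ (Finset.mem_erase.2 ⟨hij.symm, Finset.mem_univ j⟩),
          Finset.prod_eq_one fun k hk => ?_]
        · simp
        · simp only [Finset.mem_erase, Finset.mem_univ, and_true] at hk
          simp [hk.1, hk.2]
      · obtain ⟨k, hk⟩ : ∃ k, W ω k ∉ inStratum S (t k) := by
          by_contra! hc
          exact hω (funext hc)
        rw [Set.indicator_of_notMem hω]
        exact (Finset.prod_eq_zero (Finset.mem_univ k) (Set.indicator_of_notMem hk _)).symm
    · simp only [true_or, if_true]
      rw [integral_indicator (measurableSet_inStratum hS _)]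
      exact h0 _
  -- Given the strata, the assignment factor splits off by conditional independence. It is kept
  -- multiplied by the probability of the event, so null values of the strata are covered too.
  rw [setIntegral_eq_real_mul_integral_cond] at hzero ⊢
  have : ∀ ω, c (W ω i) * b (A ω i) * (c (W ω j) * b (A ω j))
      = (c (W ω i) * c (W ω j)) * (b (A ω i) * b (A ω j)) := fun ω => by ring
  simp_rw [this]
  rw [hind'.integral_fun_mul_eq_mul_integral
    ((hc.comp (hWi i)).mul (hc.comp (hWi j))).aestronglyMeasurable
    ((hb.comp (hAi i)).mul (hb.comp (hAi j))).aestronglyMeasurable, ← mul_assoc, hzero, zero_mul]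

theorem integral_mul_eq_zero_of_map_eq_pi {Ω E : Type*} [MeasurableSpace Ω] [MeasurableSpace E]
    {μ : Measure Ω} {Q : Measure E} [IsProbabilityMeasure Q] {n : ℕ} {W : Ω → Fin n → E}
    (hW : Measurable W) (hlaw : μ.map W = Measure.pi fun _ => Q) {c : E → ℝ} (hc : Measurable c)
    (h0 : ∫ w, c w ∂Q = 0) {i j : Fin n} (hij : i ≠ j) :
    ∫ ω, c (W ω i) * c (W ω j) ∂μ = 0 := by
  have hprod := integral_prod_of_map_eq_pi hW hlaw
    (φ := fun k w => if k = i ∨ k = j then c w else 1)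
    (fun k => by split_ifs <;> fun_prop)
  rw [Finset.prod_eq_zero (i := i) (Finset.mem_univ i) (by simpa using h0)] at hprod
  rw [← hprod]
  refine integral_congr_ae (ae_of_all _ fun ω => ?_)
  simp only
  rw [← Finset.mul_prod_erase _ _ (Finset.mem_univ i),
    ← Finset.mul_prod_erase _ _ (Finset.mem_erase.2 ⟨hij.symm, Finset.mem_univ j⟩),
    Finset.prod_eq_one fun k hk => ?_]
  · simp
  · simp only [Finset.mem_erase, Finset.mem_univ, and_true] at hk
    simp [hk.1, hk.2]

end Sample

/-! ### Centring at the stratum mean -/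

section Centering

variable {𝒵 𝒮 : Type*} [MeasurableSpace 𝒵]

theorem MeasureTheory.Integrable.cond {Ω : Type*} [MeasurableSpace Ω] {μ : Measure Ω}
    {f : Ω → ℝ} (hf : Integrable f μ) (B : Set Ω) : Integrable f μ[|B] := by
  by_cases h : μ B = 0
  · have : μ[|B] = 0 := cond_eq_zero_of_meas_eq_zero h
    rw [this]
    exact integrable_zero_measure
  · exact hf.integrableOn.smul_measure (ENNReal.inv_ne_top.2 h)

/-- `g - E[g | S = s]` on stratum `s`, and `0` on the other strata. -/
def centered (Q : Measure (Participant 𝒵)) (S : 𝒵 → 𝒮) (s : 𝒮) (g : Participant 𝒵 → ℝ) :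
    Participant 𝒵 → ℝ :=
  (inStratum S s).indicator fun w => g w - ∫ v, g v ∂Q[|inStratum S s]

variable {S : 𝒵 → 𝒮} {Q : Measure (Participant 𝒵)}

theorem measurable_centered [MeasurableSpace 𝒮] [MeasurableSingletonClass 𝒮] (hS : Measurable S)
    (s : 𝒮) {g : Participant 𝒵 → ℝ} (hg : Measurable g) : Measurable (centered Q S s g) :=
  (hg.sub_const _).indicator (measurableSet_inStratum hS s)

theorem centered_sub (s : 𝒮) {f g : Participant 𝒵 → ℝ} (hf : Integrable f Q)
    (hg : Integrable g Q) (w : Participant 𝒵) :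
    centered Q S s (fun w => g w - f w) w = centered Q S s g w - centered Q S s f w := by
  unfold centered
  rw [integral_sub (hg.cond _) (hf.cond _)]
  by_cases hw : w ∈ inStratum S s
  · simp only [Set.indicator_of_mem hw]
    ring
  · simp only [Set.indicator_of_notMem hw, sub_zero]

theorem abs_centered_le (s : 𝒮) {g : Participant 𝒵 → ℝ} {K : ℝ} (hK : ∀ w, |g w| ≤ K)
    (w : Participant 𝒵) : |centered Q S s g w| ≤ 2 * K := by
  have hK0 : 0 ≤ K := (abs_nonneg _).trans (hK w)
  have hm : |∫ v, g v ∂Q[|inStratum S s]| ≤ K := by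
    have := norm_integral_le_of_norm_le_const (μ := Q[|inStratum S s]) (f := g) (C := K)
      (ae_of_all _ hK)
    refine this.trans (mul_le_of_le_one_right hK0 measureReal_le_one)
  unfold centered
  by_cases hw : w ∈ inStratum S s
  · rw [Set.indicator_of_mem hw]
    exact (abs_sub _ _).trans (by linarith [hK w])
  · rw [Set.indicator_of_notMem hw, abs_zero]
    positivity

variable [MeasurableSpace 𝒮] [MeasurableSingletonClass 𝒮] [IsProbabilityMeasure Q]

/-- For `t = s` the mean has been subtracted; for `t ≠ s` the function vanishes on the stratum. -/
theorem setIntegral_centered (hS : Measurable S) (s t : 𝒮) {g : Participant 𝒵 → ℝ}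
    (hg : Integrable g Q) : ∫ w in inStratum S t, centered Q S s g w ∂Q = 0 := by
  unfold centered
  rw [setIntegral_indicator (measurableSet_inStratum hS s)]
  by_cases hts : t = s
  · subst hts
    rw [Set.inter_self, integral_sub hg.integrableOn (integrable_const _),
      setIntegral_eq_real_mul_integral_cond, setIntegral_const, smul_eq_mul, sub_self]
  · have : inStratum S t ∩ inStratum S s = ∅ := by
      ext w
      simp only [inStratum, Set.mem_inter_iff, Set.mem_empty_iff_false, iff_false]
      rintro ⟨h1, h2⟩
      exact hts (h1.symm.trans h2)
    rw [this, setIntegral_empty]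

theorem integrable_centered (hS : Measurable S) (s : 𝒮) {g : Participant 𝒵 → ℝ}
    (hg : Integrable g Q) : Integrable (centered Q S s g) Q :=
  (hg.sub (integrable_const _)).indicator (measurableSet_inStratum hS s)

/-- The factor 2 arises because the subtracted mean contributes `Q(B) |m|`, itself at most `∫ |g|`.
-/
theorem integral_abs_centered_le (hS : Measurable S) (s : 𝒮) {g : Participant 𝒵 → ℝ}
    (hg : Integrable g Q) : ∫ w, |centered Q S s g w| ∂Q ≤ 2 * ∫ w, |g w| ∂Q := by
  set B := inStratum S s with hB
  have hBm : MeasurableSet B := measurableSet_inStratum hS s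
  set m := ∫ v, g v ∂Q[|B] with hm
  have h1 : ∀ w, |centered Q S s g w| ≤ |g w| + B.indicator (fun _ => |m|) w := fun w => by
    unfold centered
    by_cases hw : w ∈ B
    · rw [Set.indicator_of_mem hw, Set.indicator_of_mem hw]
      exact abs_sub _ _
    · rw [Set.indicator_of_notMem hw, Set.indicator_of_notMem hw, abs_zero, add_zero]
      exact abs_nonneg _
  have h2 : Q.real B * |m| ≤ ∫ w, |g w| ∂Q := by
    rw [← abs_of_nonneg (measureReal_nonneg (μ := Q) (s := B)), ← abs_mul, hm,
      ← setIntegral_eq_real_mul_integral_cond]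
    exact (abs_integral_le_integral_abs).trans
      (setIntegral_le_integral hg.abs (ae_of_all _ fun w => abs_nonneg _))
  calc ∫ w, |centered Q S s g w| ∂Q ≤ ∫ w, (|g w| + B.indicator (fun _ => |m|) w) ∂Q :=
        integral_mono (integrable_centered hS s hg).abs
          (hg.abs.add ((integrable_const _).indicator hBm)) h1
    _ = ∫ w, |g w| ∂Q + Q.real B * |m| := by
        rw [integral_add hg.abs ((integrable_const _).indicator hBm), integral_indicator hBm,
          setIntegral_const, smul_eq_mul]
    _ ≤ 2 * ∫ w, |g w| ∂Q := by linarith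

end Centering

/-! ### Weighted averages: from bounded to integrable functions -/

theorem real_le_abs_weighted_average_le {Ω E : Type*} [MeasurableSpace Ω] [MeasurableSpace E]
    {μ : Measure Ω} [IsProbabilityMeasure μ] {Q : Measure E} [IsProbabilityMeasure Q] {n : ℕ}
    {W : Ω → Fin n → E} {A : Ω → Fin n → Bool} (hW : Measurable W)
    (hlaw : μ.map W = Measure.pi fun _ => Q) {r : E → ℝ} (hr : Integrable r Q)
    {b : Bool → ℝ} (hb : ∀ a, |b a| ≤ 1) {ε : ℝ} (hε : 0 < ε) :
    μ.real {ω | ε ≤ |1 / (n : ℝ) * ∑ i, r (W ω i) * b (A ω i)|} ≤ (∫ w, |r w| ∂Q) / ε := by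
  rcases Nat.eq_zero_or_pos n with rfl | hn
  · simp only [CharP.cast_eq_zero, div_zero, zero_mul, abs_zero, hε.not_ge]
    have : 0 ≤ ∫ w, |r w| ∂Q := integral_nonneg fun w => abs_nonneg _
    simpa using by positivity
  have hn' : (0 : ℝ) < n := by exact_mod_cast hn
  have hWi : ∀ i, Measurable fun ω => W ω i := fun i => (measurable_pi_apply i).comp hW
  have hint : ∀ i, Integrable (fun ω => |r (W ω i)|) μ := fun i => by
    have := hr.abs
    rw [← map_eval_of_map_eq_pi hW hlaw i] at this
    exact this.comp_measurable (hWi i)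
  have hval : ∀ i, ∫ ω, |r (W ω i)| ∂μ = ∫ w, |r w| ∂Q := fun i => by
    have h := hr.abs.aestronglyMeasurable
    rw [← map_eval_of_map_eq_pi hW hlaw i] at h
    rw [← integral_map (hWi i).aemeasurable h, map_eval_of_map_eq_pi hW hlaw i]
  have hmarkov := mul_meas_ge_le_integral_of_nonneg (μ := μ)
    (f := fun ω => ∑ i, |r (W ω i)|)
    (ae_of_all _ fun ω => Finset.sum_nonneg fun i _ => abs_nonneg _)
    (integrable_finsetSum _ fun i _ => hint i) (n * ε)
  rw [integral_finsetSum _ fun i _ => hint i] at hmarkov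
  simp only [hval, Finset.sum_const, Finset.card_univ, Fintype.card_fin, nsmul_eq_mul] at hmarkov
  have hset : {ω | ε ≤ |1 / (n : ℝ) * ∑ i, r (W ω i) * b (A ω i)|} ⊆
      {ω | n * ε ≤ ∑ i, |r (W ω i)|} := fun ω (hω : ε ≤ _) => by
    rw [abs_mul, abs_of_pos (by positivity : 0 < 1 / (n : ℝ)), one_div_mul_eq_div,
      le_div_iff₀ hn'] at hω
    have h1 : |∑ i, r (W ω i) * b (A ω i)| ≤ ∑ i, |r (W ω i)| :=
      (Finset.abs_sum_le_sum_abs _ _).trans (Finset.sum_le_sum fun i _ => by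
        rw [abs_mul]
        exact mul_le_of_le_one_right (abs_nonneg _) (hb _))
    change n * ε ≤ _
    linarith
  rw [le_div_iff₀ hε]
  have h2 := (mul_le_mul_of_nonneg_left (measureReal_mono (μ := μ) hset)
    (by positivity : 0 ≤ n * ε)).trans hmarkov
  nlinarith

section LLN

variable {𝒵 𝒮 : Type*} [MeasurableSpace 𝒵] {S : 𝒵 → 𝒮}
  {Q : Measure (Participant 𝒵)} [IsProbabilityMeasure Q] {Ω : ℕ → Type*}
  [∀ n, MeasurableSpace (Ω n)] {μ : ∀ n, Measure (Ω n)} [∀ n, IsProbabilityMeasure (μ n)]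
  {W : ∀ n, Ω n → Fin n → Participant 𝒵} {A : ∀ n, Ω n → Fin n → Bool}

theorem eventually_div_nat_mul_le (K : ℝ) {c η : ℝ} (hη : 0 < η) :
    ∀ᶠ n : ℕ in atTop, K / (n * c) ≤ η := by
  have h : Tendsto (fun n : ℕ => K / c / n) atTop (𝓝 0) := tendsto_const_div_atTop_nhds_zero_nat _
  filter_upwards [h.eventually (gt_mem_nhds hη)] with n hn
  rw [mul_comm, ← div_div]
  exact hn.le

/-- The weighted averages of a function centred in the stratum `s` vanish asymptotically. -/
theorem tendsto_average_centered [Finite 𝒮] [MeasurableSpace 𝒮] [MeasurableSingletonClass 𝒮]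
    (hS : Measurable S) (hW : ∀ n, Measurable (W n))
    (hlaw : ∀ n, (μ n).map (W n) = Measure.pi fun _ => Q) (hA : ∀ n, Measurable (A n))
    (hind : ∀ n (t : Fin n → 𝒮), IndepFun (W n) (A n) (μ n)[|strata S (W n) ⁻¹' {t}])
    (s : 𝒮) {g : Participant 𝒵 → ℝ} (hg : Integrable g Q)
    {b : Bool → ℝ} (hb : ∀ a, |b a| ≤ 1) :
    Tendsto (fun x : Σ n, Ω n =>
      1 / (x.1 : ℝ) * ∑ i, centered Q S s g (W x.1 x.2 i) * b (A x.1 x.2 i))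
      (probFilter μ) (𝓝 0) := by
  refine tendsto_probFilter_of_real_le
    (X := fun n ω => 1 / (n : ℝ) * ∑ i, centered Q S s g (W n ω i) * b (A n ω i))
    fun ε hε η hη => ?_
  -- The factor 8 is 2 for the loss in centring, 2 for the threshold `ε / 2` in Markov's inequality
  -- and 2 for the share `η / 2` of the probability.
  obtain ⟨f, hf, hfm⟩ := (memLp_one_iff_integrable.2 hg).exists_simpleFunc_eLpNorm_sub_lt
    ENNReal.one_ne_top (ε := ENNReal.ofReal (ε * η / 8)) (by simpa using by positivity)
  have hfi : Integrable f Q := memLp_one_iff_integrable.1 hfm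
  have hL1 : ∫ w, |g w - f w| ∂Q ≤ ε * η / 8 := by
    rw [eLpNorm_one_eq_lintegral_enorm] at hf
    have := integral_norm_eq_lintegral_enorm (hg.sub hfi).aestronglyMeasurable
    simp only [Real.norm_eq_abs, Pi.sub_apply] at this hf
    rw [this]
    exact ENNReal.toReal_le_of_le_ofReal (by positivity) hf.le
  obtain ⟨K, hK⟩ := f.exists_forall_norm_le
  filter_upwards [eventually_div_nat_mul_le ((2 * K) ^ 2) (c := (ε / 2) ^ 2) (half_pos hη)]
    with n hn
  have hWi : ∀ i, Measurable fun ω => W n ω i := fun i => (measurable_pi_apply i).comp (hW n)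
  have hAi : ∀ i, Measurable fun ω => A n ω i := fun i => (measurable_pi_apply i).comp (hA n)
  have h1 : (μ n).real {ω | ε / 2 ≤
      |1 / (n : ℝ) * ∑ i, centered Q S s f (W n ω i) * b (A n ω i)|} ≤ η / 2 := by
    refine (real_le_abs_average_le (K := 2 * K) (fun i => ?_) (fun i ω => ?_) (fun i j hij => ?_)
      (half_pos hε)).trans hn
    · exact ((measurable_centered hS s f.measurable).comp (hWi i)).mul
        ((measurable_of_finite b).comp (hAi i))
    · rw [abs_mul]
      exact (mul_le_of_le_one_right (abs_nonneg _) (hb _)).trans (abs_centered_le s hK _)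
    · exact integral_mul_eq_zero_of_cond_indep hS (hW n) (hlaw n) (hA n) (hind n)
        (measurable_centered hS s f.measurable) (abs_centered_le s hK)
        (fun t => setIntegral_centered hS s t hfi) hij
  have h2 : (μ n).real {ω | ε / 2 ≤
      |1 / (n : ℝ) * ∑ i, centered Q S s (fun w => g w - f w) (W n ω i) * b (A n ω i)|}
      ≤ η / 2 := by
    refine (real_le_abs_weighted_average_le (hW n) (hlaw n)
      (integrable_centered hS s (hg.sub hfi)) hb (half_pos hε)).trans ?_
    rw [div_le_iff₀ (half_pos hε)]
    refine (integral_abs_centered_le hS s (hg.sub hfi)).trans ?_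
    simp only [Pi.sub_apply]
    linarith
  refine (measureReal_mono (fun ω (hω : ε ≤ _) => ?_)).trans ((measureReal_union_le _ _).trans
    ((add_le_add h1 h2).trans_eq (add_halves η)))
  by_contra hc
  simp only [Set.mem_union, Set.mem_ofPred_eq, not_or, not_le] at hc
  have hsum : 1 / (n : ℝ) * ∑ i, centered Q S s g (W n ω i) * b (A n ω i)
      = 1 / (n : ℝ) * ∑ i, centered Q S s f (W n ω i) * b (A n ω i)
        + 1 / (n : ℝ) * ∑ i, centered Q S s (fun w => g w - f w) (W n ω i) * b (A n ω i) := by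
    rw [← mul_add, ← Finset.sum_add_distrib]
    congr 1
    refine Finset.sum_congr rfl fun i _ => ?_
    rw [centered_sub s hfi hg]
    ring
  rw [hsum] at hω
  linarith [abs_add_le (1 / (n : ℝ) * ∑ i, centered Q S s f (W n ω i) * b (A n ω i))
    (1 / (n : ℝ) * ∑ i, centered Q S s (fun w => g w - f w) (W n ω i) * b (A n ω i))]

/-- The law of large numbers for the relative sizes of the strata. -/
theorem tendsto_stratum_frequency [DecidableEq 𝒮] [MeasurableSpace 𝒮] [MeasurableSingletonClass 𝒮]
    (hS : Measurable S) (hW : ∀ n, Measurable (W n))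
    (hlaw : ∀ n, (μ n).map (W n) = Measure.pi fun _ => Q) (s : 𝒮) :
    Tendsto (fun x : Σ n, Ω n => (observe S (W x.1 x.2) (A x.1 x.2)).nS s / x.1)
      (probFilter μ) (𝓝 (pS Q S s)) := by
  have hm : MeasurableSet (inStratum S s) := measurableSet_inStratum hS s
  set c : Participant 𝒵 → ℝ := fun w => (inStratum S s).indicator 1 w - pS Q S s with hc
  have hcm : Measurable c := (measurable_one.indicator hm).sub_const _
  have hp0 : 0 ≤ pS Q S s := measureReal_nonneg
  have hp1 : pS Q S s ≤ 1 := measureReal_le_one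
  have hc1 : ∀ w, |c w| ≤ 1 := fun w => by
    rw [hc, abs_le]
    by_cases hw : w ∈ inStratum S s
    · simp only [Set.indicator_of_mem hw, Pi.one_apply]
      constructor <;> linarith
    · simp only [Set.indicator_of_notMem hw]
      constructor <;> linarith
  have hc0 : ∫ w, c w ∂Q = 0 := by
    rw [hc, integral_sub ((integrable_const 1).indicator hm) (integrable_const _),
      integral_indicator_one hm]
    simp [pS]
  have key := tendsto_probFilter_of_real_le (μ := μ)
    (X := fun n ω => 1 / (n : ℝ) * ∑ i, c (W n ω i)) fun ε hε η hη => by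
      filter_upwards [eventually_div_nat_mul_le (1 ^ 2) (c := ε ^ 2) hη] with n hn
      exact (real_le_abs_average_le (fun i => hcm.comp ((measurable_pi_apply i).comp (hW n)))
        (fun i ω => hc1 _) (fun i j hij => integral_mul_eq_zero_of_map_eq_pi (hW n) (hlaw n)
          hcm hc0 hij) hε).trans hn
  have key2 := key.add_const (pS Q S s)
  rw [zero_add] at key2
  refine key2.congr' ?_
  -- For `n = 0` every average is 0 by convention and adding `pS Q S s` back would be wrong; hence
  -- `n > 0`.
  filter_upwards [eventually_probFilter_of_atTop (μ := μ) (eventually_gt_atTop 0)] with x hx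
  have hx' : (x.1 : ℝ) ≠ 0 := by exact_mod_cast hx.ne'
  have hN : ∑ i, (inStratum S s).indicator (1 : Participant 𝒵 → ℝ) (W x.1 x.2 i)
      = (observe S (W x.1 x.2) (A x.1 x.2)).nS s :=
    Finset.sum_congr rfl fun i _ => by
      classical
      rw [Set.indicator_apply, Pi.one_apply]
      exact if_congr Iff.rfl rfl rfl
  simp only [hc, Finset.sum_sub_distrib, Finset.sum_const, Finset.card_univ, Fintype.card_fin,
    nsmul_eq_mul, hN]
  field_simp
  ring

end LLN

/-! ### Consequences of conditional convergence in law -/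

/-- A continuous function of the coordinate `s` that vanishes on `[-K, K]` and equals `1` off
`(-K - 1, K + 1)`. -/
def tailBump {ι : Type*} (s : ι) (K : ℝ) : (ι → ℝ) →ᵇ ℝ :=
  BoundedContinuousFunction.ofNormedAddCommGroup (fun x => min 1 (max 0 (|x s| - K)))
    (by fun_prop) 1 fun x => by
      rw [Real.norm_eq_abs, abs_of_nonneg (le_min zero_le_one (le_max_left _ _))]
      exact min_le_left _ _

section TailBump

variable {ι : Type*} (s : ι)

theorem tailBump_apply (K : ℝ) (x : ι → ℝ) : tailBump s K x = min 1 (max 0 (|x s| - K)) := rfl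

theorem tailBump_nonneg (K : ℝ) (x : ι → ℝ) : 0 ≤ tailBump s K x :=
  le_min zero_le_one (le_max_left _ _)

theorem tailBump_le_one (K : ℝ) (x : ι → ℝ) : tailBump s K x ≤ 1 := min_le_left _ _

theorem tailBump_eq_one {K : ℝ} {x : ι → ℝ} (h : K + 1 ≤ |x s|) : tailBump s K x = 1 :=
  min_eq_left (le_max_of_le_right (by linarith))

theorem tendsto_integral_tailBump [Countable ι] (ν : Measure (ι → ℝ)) [IsFiniteMeasure ν] :
    Tendsto (fun K : ℕ => ∫ x, tailBump s K x ∂ν) atTop (𝓝 0) := by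
  rw [← integral_zero (ι → ℝ) ℝ (μ := ν)]
  refine tendsto_integral_of_dominated_convergence (fun _ => 1)
    (fun K => (tailBump s K).continuous.aestronglyMeasurable) (integrable_const _)
    (fun K => ae_of_all _ fun x => ?_) (ae_of_all _ fun x => ?_)
  · rw [Real.norm_eq_abs, abs_of_nonneg (tailBump_nonneg s _ x)]
    exact tailBump_le_one s _ x
  · refine tendsto_const_nhds.congr' ?_
    filter_upwards [(tendsto_natCast_atTop_atTop (R := ℝ)).eventually_ge_atTop |x s|] with K hK
    rw [tailBump_apply, max_eq_left (by linarith), min_eq_right zero_le_one]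

end TailBump

/-- Total probability over the values of `T`: fibres in `M` contribute at most `I` in all, the
others at most their own probability because `f ≤ 1`. -/
theorem integral_le_add_of_fibers {Ω 𝒯 : Type*} [MeasurableSpace Ω] {μ : Measure Ω}
    [IsProbabilityMeasure μ] [Finite 𝒯] (T : Ω → 𝒯) (hT : ∀ t, MeasurableSet (T ⁻¹' {t}))
    {f : Ω → ℝ} (hf : Measurable f) (hf0 : ∀ ω, 0 ≤ f ω) (hf1 : ∀ ω, f ω ≤ 1) (M : Set 𝒯)
    {I : ℝ} (hI0 : 0 ≤ I)
    (hI : ∀ t ∈ M, μ (T ⁻¹' {t}) ≠ 0 → ∫ ω, f ω ∂μ[|T ⁻¹' {t}] ≤ I) :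
    ∫ ω, f ω ∂μ ≤ I + (1 - μ.real (T ⁻¹' M)) := by
  classical
  have := Fintype.ofFinite 𝒯
  have hfi : Integrable f μ := Integrable.of_bound hf.aestronglyMeasurable 1
    (ae_of_all _ fun ω => by rw [Real.norm_eq_abs, abs_of_nonneg (hf0 ω)]; exact hf1 ω)
  have hU : (⋃ t, T ⁻¹' {t}) = Set.univ := by
    ext ω
    simp
  have hM : μ.real (T ⁻¹' M) = ∑ t, if t ∈ M then μ.real (T ⁻¹' {t}) else 0 := by
    rw [← Finset.sum_filter, sum_measureReal_preimage_singleton _ fun t _ => hT t]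
    simp
  have h1 : ∑ t, μ.real (T ⁻¹' {t}) = 1 := by
    rw [sum_measureReal_preimage_singleton _ fun t _ => hT t]
    simp
  rw [← setIntegral_univ, ← hU, integral_iUnion_fintype hT
    (fun s t hst => Disjoint.preimage T (by simpa using hst)) fun t => hfi.integrableOn]
  have hle : ∀ t, ∫ ω in T ⁻¹' {t}, f ω ∂μ ≤ μ.real (T ⁻¹' {t}) * I
      + (μ.real (T ⁻¹' {t}) - if t ∈ M then μ.real (T ⁻¹' {t}) else 0) := fun t => by
    rw [setIntegral_eq_real_mul_integral_cond]
    by_cases ht0 : μ (T ⁻¹' {t}) = 0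
    · simp [measureReal_def, ht0]
    have hr : 0 ≤ μ.real (T ⁻¹' {t}) := measureReal_nonneg
    by_cases ht : t ∈ M
    · rw [if_pos ht, sub_self, add_zero]
      exact mul_le_mul_of_nonneg_left (hI t ht ht0) hr
    · rw [if_neg ht, sub_zero]
      have : IsProbabilityMeasure μ[|T ⁻¹' {t}] := cond_isProbabilityMeasure ht0
      have h2 : ∫ ω, f ω ∂μ[|T ⁻¹' {t}] ≤ 1 :=
        (integral_mono (hfi.cond _) (integrable_const 1) hf1).trans_eq (by simp)
      nlinarith [mul_nonneg hr hI0]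
  refine (Finset.sum_le_sum fun t _ => hle t).trans_eq ?_
  rw [Finset.sum_add_distrib, Finset.sum_sub_distrib, ← Finset.sum_mul, h1, ← hM, one_mul]

/-- Conditional convergence in law with probability approaching one implies tightness. -/
theorem CondTendstoInLawWpa1.eventually_real_le {Ω : ℕ → Type*} [∀ n, MeasurableSpace (Ω n)]
    {μ : ∀ n, Measure (Ω n)} [∀ n, IsProbabilityMeasure (μ n)] {𝒯 : ℕ → Type*}
    [∀ n, Finite (𝒯 n)] {ι : Type*} [Countable ι] {T : ∀ n, Ω n → 𝒯 n}
    {X : ∀ n, Ω n → ι → ℝ} {ν : Measure (ι → ℝ)} [IsFiniteMeasure ν]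
    (h : CondTendstoInLawWpa1 μ T X ν) (hT : ∀ n t, MeasurableSet (T n ⁻¹' {t}))
    (hX : ∀ n, Measurable (X n)) (s : ι) {η : ℝ} (hη : 0 < η) :
    ∃ K : ℝ, ∀ᶠ n in atTop, (μ n).real {ω | K ≤ |X n ω s|} ≤ η := by
  classical
  obtain ⟨M, hM, hlim⟩ := h
  obtain ⟨K, hK⟩ := ((tendsto_integral_tailBump s ν).eventually
    (gt_mem_nhds (by positivity : 0 < η / 2))).exists
  have hMr : Tendsto (fun n => (μ n).real (T n ⁻¹' M n)) atTop (𝓝 1) := by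
    have := (ENNReal.tendsto_toReal ENNReal.one_ne_top).comp hM
    rw [ENNReal.toReal_one] at this
    exact this
  set J : ∀ n, 𝒯 n → ℝ := fun n t => ∫ ω, tailBump s K (X n ω) ∂(μ n)[|T n ⁻¹' {t}] with hJ
  -- The hypothesis speaks of one sequence of values at a time, whereas a bound uniform over `M n`
  -- is needed. Since there are finitely many values, the worst one can serve as the sequence. If no
  -- value is admissible the choice is arbitrary; `hgood` excludes this for large `n`.
  have hmax : ∀ n, ∃ t : 𝒯 n, (∃ t', t' ∈ M n ∧ μ n (T n ⁻¹' {t'}) ≠ 0) →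
      (t ∈ M n ∧ μ n (T n ⁻¹' {t}) ≠ 0) ∧
        ∀ t' ∈ M n, μ n (T n ⁻¹' {t'}) ≠ 0 → J n t' ≤ J n t := fun n => by
    by_cases hex : ∃ t', t' ∈ M n ∧ μ n (T n ⁻¹' {t'}) ≠ 0
    · obtain ⟨t, ht, htmax⟩ := Set.exists_max_image {t | t ∈ M n ∧ μ n (T n ⁻¹' {t}) ≠ 0} (J n)
        (Set.toFinite _) hex
      exact ⟨t, fun _ => ⟨ht, fun t' h1 h2 => htmax t' ⟨h1, h2⟩⟩⟩
    · obtain ⟨ω⟩ := nonempty_of_isProbabilityMeasure (μ n)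
      exact ⟨T n ω, fun h => absurd h hex⟩
  choose t ht using hmax
  have hgood : ∀ᶠ n in atTop, ∃ t', t' ∈ M n ∧ μ n (T n ⁻¹' {t'}) ≠ 0 := by
    filter_upwards [hMr.eventually (lt_mem_nhds one_pos)] with n hn
    by_contra! hc
    refine hn.ne' ?_
    rw [measureReal_eq_zero_iff]
    have : T n ⁻¹' M n = ⋃ t ∈ M n, T n ⁻¹' {t} := by
      ext ω
      simp
    rw [this]
    exact (measure_biUnion_null_iff (Set.to_countable _)).2 hc
  have hJt : ∀ᶠ n in atTop, J n (t n) < η / 2 :=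
    (hlim t (hgood.mono fun n hn => (ht n hn).1) (tailBump s K)).eventually (gt_mem_nhds hK)
  refine ⟨K + 1, ?_⟩
  filter_upwards [hgood, hJt, hMr.eventually (lt_mem_nhds (by linarith : 1 - η / 2 < 1))]
    with n hn hJn hMn
  have hmeas : Measurable fun ω => tailBump s K (X n ω) := by
    simp only [tailBump_apply]
    have := (measurable_pi_apply s).comp (hX n)
    simp only [Function.comp_def] at this
    fun_prop
  have hle := integral_le_add_of_fibers (μ := μ n) (T n) (hT n) hmeas
    (fun ω => tailBump_nonneg s _ _) (fun ω => tailBump_le_one s _ _) (M n)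
    (integral_nonneg fun ω => tailBump_nonneg s _ _) (ht n hn).2
  have hmarkov := mul_meas_ge_le_integral_of_nonneg (μ := μ n)
    (f := fun ω => tailBump s K (X n ω)) (ae_of_all _ fun ω => tailBump_nonneg s _ _)
    (Integrable.of_bound hmeas.aestronglyMeasurable 1 (ae_of_all _ fun ω => by
      rw [Real.norm_eq_abs, abs_of_nonneg (tailBump_nonneg s _ _)]
      exact tailBump_le_one s _ _)) 1
  rw [one_mul] at hmarkov
  have hsub : {ω | (K : ℝ) + 1 ≤ |X n ω s|} ⊆ {ω | 1 ≤ tailBump s K (X n ω)} :=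
    fun ω hω => (tailBump_eq_one s hω).ge
  have := measureReal_mono (μ := μ n) hsub
  linarith

/-- If `√n (R n - c)` converges in law conditionally on `T n` with probability approaching one,
then `R n` converges to `c` in probability. -/
theorem CondTendstoInLawWpa1.tendsto_probFilter {Ω : ℕ → Type*} [∀ n, MeasurableSpace (Ω n)]
    {μ : ∀ n, Measure (Ω n)} [∀ n, IsProbabilityMeasure (μ n)] {𝒯 : ℕ → Type*}
    [∀ n, Finite (𝒯 n)] {ι : Type*} [Countable ι] {T : ∀ n, Ω n → 𝒯 n}
    {R : ∀ n, Ω n → ι → ℝ} {c : ℝ} {ν : Measure (ι → ℝ)} [IsFiniteMeasure ν]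
    (h : CondTendstoInLawWpa1 μ T (fun n ω s => √(n : ℝ) * (R n ω s - c)) ν)
    (hT : ∀ n t, MeasurableSet (T n ⁻¹' {t})) (hR : ∀ n, Measurable (R n)) (s : ι) :
    Tendsto (fun x : Σ n, Ω n => R x.1 x.2 s) (probFilter μ) (𝓝 c) := by
  have key : Tendsto (fun x : Σ n, Ω n => R x.1 x.2 s - c) (probFilter μ) (𝓝 0) := by
    refine tendsto_probFilter_of_real_le (X := fun n ω => R n ω s - c) fun ε hε η hη => ?_
    obtain ⟨K, hK⟩ := h.eventually_real_le hT (fun n => measurable_pi_lambda _ fun s =>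
      (((measurable_pi_apply s).comp (hR n)).sub_const c).const_mul _) s hη
    have hsqrt : Tendsto (fun n : ℕ => √(n : ℝ)) atTop atTop :=
      Real.tendsto_sqrt_atTop.comp tendsto_natCast_atTop_atTop
    filter_upwards [hK, hsqrt.eventually_ge_atTop (K / ε)] with n hn hn2
    refine (measureReal_mono fun ω (hω : ε ≤ _) => ?_).trans hn
    rw [div_le_iff₀ hε] at hn2
    rw [Set.mem_ofPred_eq, abs_mul, abs_of_nonneg (Real.sqrt_nonneg _)]
    exact hn2.trans (mul_le_mul_of_nonneg_left hω (Real.sqrt_nonneg _))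
  simpa using key.add_const c

/-! ### The estimators as functions of cell averages -/

namespace ObsData

variable {n : ℕ} {𝒮 : Type*} [DecidableEq 𝒮]

/-- `(1/n) ∑ᵢ I{D_i = d, A_i = a, S_i = s} Y_i ^ k`. -/
def cellMoment (x : ObsData n 𝒮) (d a : Bool) (s : 𝒮) (k : ℕ) : ℝ :=
  1 / n * ∑ i, (if x.D i = d ∧ x.A i = a ∧ x.S i = s then 1 else 0) * x.Y i ^ k

/-- Counts are sums of cell moments of order `k = 0`, so convergence of the cell moments alone
drives every estimator. -/
theorem nS_div (x : ObsData n 𝒮) (s : 𝒮) :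
    x.nS s / n = x.cellMoment true true s 0 + x.cellMoment false true s 0
      + x.cellMoment true false s 0 + x.cellMoment false false s 0 := by
  simp only [nS, cellMoment, one_div_mul_eq_div, ← add_div, ← Finset.sum_add_distrib]
  congr 1
  refine Finset.sum_congr rfl fun i _ => ?_
  cases x.D i <;> cases x.A i <;> by_cases h : x.S i = s <;> simp [h]

theorem nA_div (x : ObsData n 𝒮) (s : 𝒮) :
    x.nA s / n = x.cellMoment true true s 0 + x.cellMoment false true s 0 := by
  simp only [nA, cellMoment, one_div_mul_eq_div, ← add_div, ← Finset.sum_add_distrib]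
  congr 1
  refine Finset.sum_congr rfl fun i _ => ?_
  cases x.D i <;> cases x.A i <;> by_cases h : x.S i = s <;> simp [h]

theorem nD_div (x : ObsData n 𝒮) (s : 𝒮) :
    x.nD s / n = x.cellMoment true true s 0 + x.cellMoment true false s 0 := by
  simp only [nD, cellMoment, one_div_mul_eq_div, ← add_div, ← Finset.sum_add_distrib]
  congr 1
  refine Finset.sum_congr rfl fun i _ => ?_
  cases x.D i <;> cases x.A i <;> by_cases h : x.S i = s <;> simp [h]

theorem nAD_div (x : ObsData n 𝒮) (s : 𝒮) :
    x.nAD s / n = x.cellMoment true true s 0 := by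
  simp only [nAD, cellMoment, one_div_mul_eq_div]
  congr 1
  refine Finset.sum_congr rfl fun i _ => ?_
  cases x.D i <;> cases x.A i <;> by_cases h : x.S i = s <;> simp [h]

/-- Products of indicators of two different strata vanish, so each block is diagonal and the
regression separates into one 2 × 2 system per stratum. -/
theorem Zsat_transpose_mul_Xsat (x : ObsData n 𝒮) :
    x.Zsatᵀ * x.Xsat = Matrix.fromBlocks (Matrix.diagonal x.nS) (Matrix.diagonal x.nD)
      (Matrix.diagonal x.nA) (Matrix.diagonal x.nAD) := by
  ext (s | s) (t | t) <;> by_cases hst : s = t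
  case pos =>
    subst hst
    simp only [Matrix.mul_apply, Matrix.transpose_apply, Zsat, Xsat, Matrix.of_apply, Sum.elim_inl,
      Matrix.fromBlocks_apply₁₁, Matrix.diagonal_apply_eq, nS]
    refine Finset.sum_congr rfl fun i _ => ?_
    by_cases h : x.S i = s <;> simp [h]
  case pos =>
    subst hst
    simp only [Matrix.mul_apply, Matrix.transpose_apply, Zsat, Xsat, Matrix.of_apply,
      Sum.elim_inl, Sum.elim_inr,
      Matrix.fromBlocks_apply₁₂, Matrix.diagonal_apply_eq, nD]
    refine Finset.sum_congr rfl fun i _ => ?_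
    cases x.D i <;> by_cases h : x.S i = s <;> simp [h, bit]
  case pos =>
    subst hst
    simp only [Matrix.mul_apply, Matrix.transpose_apply, Zsat, Xsat, Matrix.of_apply,
      Sum.elim_inl, Sum.elim_inr,
      Matrix.fromBlocks_apply₂₁, Matrix.diagonal_apply_eq, nA]
    refine Finset.sum_congr rfl fun i _ => ?_
    cases x.A i <;> by_cases h : x.S i = s <;> simp [h, bit]
  case pos =>
    subst hst
    simp only [Matrix.mul_apply, Matrix.transpose_apply, Zsat, Xsat, Matrix.of_apply, Sum.elim_inr,
      Matrix.fromBlocks_apply₂₂, Matrix.diagonal_apply_eq, nAD]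
    refine Finset.sum_congr rfl fun i _ => ?_
    cases x.D i <;> cases x.A i <;> by_cases h : x.S i = s <;> simp [h, bit]
  all_goals
    simp only [Matrix.mul_apply, Matrix.transpose_apply, Zsat, Xsat, Matrix.of_apply,
      Sum.elim_inl, Sum.elim_inr,
      Matrix.fromBlocks_apply₁₁, Matrix.fromBlocks_apply₁₂, Matrix.fromBlocks_apply₂₁,
      Matrix.fromBlocks_apply₂₂, Matrix.diagonal_apply_ne _ hst]
    refine Finset.sum_eq_zero fun i _ => ?_
    by_cases h : x.S i = s
    · have : x.S i ≠ t := fun h' => hst (h.symm.trans h')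
      simp [this]
    · simp [h]

theorem Zsat_transpose_mulVec_inl (x : ObsData n 𝒮) (s : 𝒮) :
    (x.Zsatᵀ *ᵥ x.Y) (Sum.inl s) = ∑ i, (if x.S i = s then 1 else 0) * x.Y i := rfl

theorem Zsat_transpose_mulVec_inr (x : ObsData n 𝒮) (s : 𝒮) :
    (x.Zsatᵀ *ᵥ x.Y) (Sum.inr s) = ∑ i, (bit (x.A i) * if x.S i = s then 1 else 0) * x.Y i := rfl

theorem Zsat_transpose_mulVec_inl_div (x : ObsData n 𝒮) (s : 𝒮) :
    (x.Zsatᵀ *ᵥ x.Y) (Sum.inl s) / n =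
      x.cellMoment true true s 1 + x.cellMoment false true s 1
      + x.cellMoment true false s 1 + x.cellMoment false false s 1 := by
  rw [Zsat_transpose_mulVec_inl]
  simp only [cellMoment, one_div_mul_eq_div, ← add_div, ← Finset.sum_add_distrib]
  congr 1
  refine Finset.sum_congr rfl fun i _ => ?_
  cases x.D i <;> cases x.A i <;> by_cases h : x.S i = s <;> simp [h]

theorem Zsat_transpose_mulVec_inr_div (x : ObsData n 𝒮) (s : 𝒮) :
    (x.Zsatᵀ *ᵥ x.Y) (Sum.inr s) / n =
      x.cellMoment true true s 1 + x.cellMoment false true s 1 := by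
  rw [Zsat_transpose_mulVec_inr]
  simp only [cellMoment, one_div_mul_eq_div, ← add_div, ← Finset.sum_add_distrib]
  congr 1
  refine Finset.sum_congr rfl fun i _ => ?_
  cases x.D i <;> cases x.A i <;> by_cases h : x.S i = s <;> simp [h, bit]

variable [Fintype 𝒮]

theorem Zsat_transpose_mul_Xsat_inv (x : ObsData n 𝒮)
    (hdet : ∀ s, x.nS s * x.nAD s - x.nA s * x.nD s ≠ 0) :
    (x.Zsatᵀ * x.Xsat)⁻¹ = Matrix.fromBlocks
      (Matrix.diagonal fun s => x.nAD s / (x.nS s * x.nAD s - x.nA s * x.nD s))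
      (Matrix.diagonal fun s => -(x.nD s / (x.nS s * x.nAD s - x.nA s * x.nD s)))
      (Matrix.diagonal fun s => -(x.nA s / (x.nS s * x.nAD s - x.nA s * x.nD s)))
      (Matrix.diagonal fun s => x.nS s / (x.nS s * x.nAD s - x.nA s * x.nD s)) := by
  refine Matrix.inv_eq_right_inv ?_
  rw [Zsat_transpose_mul_Xsat, Matrix.fromBlocks_multiply, ← Matrix.fromBlocks_one]
  simp only [Matrix.diagonal_mul_diagonal, Matrix.diagonal_add, ← Matrix.diagonal_one,
    ← Matrix.diagonal_zero]
  congr 2 <;> funext s <;> have := hdet s <;> field_simp <;> ring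

theorem gammaSat_eq (x : ObsData n 𝒮)
    (hdet : ∀ s, x.nS s * x.nAD s - x.nA s * x.nD s ≠ 0) (s : 𝒮) :
    x.gammaSat s = (x.nAD s * (x.Zsatᵀ *ᵥ x.Y) (Sum.inl s)
      - x.nD s * (x.Zsatᵀ *ᵥ x.Y) (Sum.inr s)) / (x.nS s * x.nAD s - x.nA s * x.nD s) := by
  rw [gammaSat, satCoef, Zsat_transpose_mul_Xsat_inv x hdet]
  generalize x.Zsatᵀ *ᵥ x.Y = v
  rw [Matrix.fromBlocks_mulVec, Sum.elim_inl, Pi.add_apply, Matrix.mulVec_diagonal,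
    Matrix.mulVec_diagonal]
  simp only [Function.comp_apply]
  ring

theorem betaSat_eq (x : ObsData n 𝒮)
    (hdet : ∀ s, x.nS s * x.nAD s - x.nA s * x.nD s ≠ 0) (s : 𝒮) :
    x.betaSat s = (x.nS s * (x.Zsatᵀ *ᵥ x.Y) (Sum.inr s)
      - x.nA s * (x.Zsatᵀ *ᵥ x.Y) (Sum.inl s)) / (x.nS s * x.nAD s - x.nA s * x.nD s) := by
  rw [betaSat, satCoef, Zsat_transpose_mul_Xsat_inv x hdet]
  generalize x.Zsatᵀ *ᵥ x.Y = v
  rw [Matrix.fromBlocks_mulVec, Sum.elim_inr, Pi.add_apply, Matrix.mulVec_diagonal,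
    Matrix.mulVec_diagonal]
  simp only [Function.comp_apply]
  ring

/-- On the cell the residual is `Y - γ̂(s) - d β̂(s)`, with coefficients common to all its members,
so the square expands in the cell moments of orders 2, 1 and 0. -/
theorem cellSq_eq (x : ObsData n 𝒮) (d a : Bool) (s : 𝒮) (c : ℝ) :
    x.cellSq d a s c = x.cellMoment d a s 2
      + 2 * (c - x.gammaSat s - bit d * x.betaSat s) * x.cellMoment d a s 1
      + (c - x.gammaSat s - bit d * x.betaSat s) ^ 2 * x.cellMoment d a s 0 := by
  have key : ∀ i, (if x.D i = d ∧ x.A i = a ∧ x.S i = s then (1 : ℝ) else 0) * (x.resid i + c) ^ 2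
      = (if x.D i = d ∧ x.A i = a ∧ x.S i = s then 1 else 0) * x.Y i ^ 2
        + 2 * (c - x.gammaSat s - bit d * x.betaSat s) *
          ((if x.D i = d ∧ x.A i = a ∧ x.S i = s then 1 else 0) * x.Y i ^ 1)
        + (c - x.gammaSat s - bit d * x.betaSat s) ^ 2 *
          ((if x.D i = d ∧ x.A i = a ∧ x.S i = s then 1 else 0) * x.Y i ^ 0) := fun i => by
    split_ifs with h
    · obtain ⟨hd, -, hs⟩ := h
      simp only [resid, hd, hs, ite_mul, mul_ite, one_mul, zero_mul, mul_one, mul_zero,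
        Finset.sum_ite_eq, Finset.mem_univ, if_true]
      ring
    · ring
  simp only [cellSq, key, Finset.sum_add_distrib, ← Finset.mul_sum, cellMoment]
  ring

end ObsData

/-! ### Limits of the estimators, given the limits of the cell averages -/

theorem tendsto_nhds_of_eq {α : Type*} {l : Filter α} {u : α → ℝ} {a b : ℝ}
    (h : Tendsto u l (𝓝 a)) (hab : a = b) : Tendsto u l (𝓝 b) :=
  hab ▸ h

/-- Along `l`, the averages over the cells `D = d, A = a, S = s` of the powers of the outcome tend
to `p s * q * e d a s k` for `a = 1` and to `p s * (1 - q) * e d a s k` for `a = 0`. Here `f a` is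
the limiting frequency of treated in the arm `a`, and `g + f a * b` the limiting mean outcome. -/
structure CellLimits {𝒮 α : Type*} [DecidableEq 𝒮] (l : Filter α) (N : α → ℕ)
    (x : ∀ ω, ObsData (N ω) 𝒮) (p : 𝒮 → ℝ) (q : ℝ) (f : Bool → 𝒮 → ℝ)
    (e : Bool → Bool → 𝒮 → ℕ → ℝ) (g b : 𝒮 → ℝ) : Prop where
  size_pos : ∀ᶠ ω in l, 0 < N ω
  tendsto : ∀ d a s k, k ≤ 2 → Tendsto (fun ω => (x ω).cellMoment d a s k) l
    (𝓝 (p s * (if a then q else 1 - q) * e d a s k))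
  p_pos : ∀ s, 0 < p s
  q_pos : 0 < q
  q_lt : q < 1
  f_lt : ∀ s, f false s < f true s
  moment_zero_true : ∀ a s, e true a s 0 = f a s
  moment_zero_false : ∀ a s, e false a s 0 = 1 - f a s
  moment_one : ∀ a s, e true a s 1 + e false a s 1 = g s + f a s * b s

namespace CellLimits

variable {𝒮 α : Type*} [DecidableEq 𝒮] {l : Filter α} {N : α → ℕ}
  {x : ∀ ω, ObsData (N ω) 𝒮} {p : 𝒮 → ℝ} {q : ℝ} {f : Bool → 𝒮 → ℝ}
  {e : Bool → Bool → 𝒮 → ℕ → ℝ} {g b : 𝒮 → ℝ} (H : CellLimits l N x p q f e g b)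

include H

theorem tendsto_nS (s : 𝒮) : Tendsto (fun ω => (x ω).nS s / N ω) l (𝓝 (p s)) := by
  simp only [ObsData.nS_div]
  have h := (((H.tendsto true true s 0 (by simp)).add (H.tendsto false true s 0 (by simp))).add
    (H.tendsto true false s 0 (by simp))).add (H.tendsto false false s 0 (by simp))
  convert h using 2
  simp only [if_true, if_false, Bool.false_eq_true, H.moment_zero_true, H.moment_zero_false]
  ring

theorem tendsto_nA (s : 𝒮) : Tendsto (fun ω => (x ω).nA s / N ω) l (𝓝 (q * p s)) := by
  simp only [ObsData.nA_div]
  have h := (H.tendsto true true s 0 (by simp)).add (H.tendsto false true s 0 (by simp))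
  convert h using 2
  simp only [if_true, H.moment_zero_true, H.moment_zero_false]
  ring

theorem tendsto_nAD (s : 𝒮) :
    Tendsto (fun ω => (x ω).nAD s / N ω) l (𝓝 (p s * q * f true s)) := by
  simp only [ObsData.nAD_div]
  simpa [H.moment_zero_true] using H.tendsto true true s 0 (by simp)

theorem tendsto_nD (s : 𝒮) :
    Tendsto (fun ω => (x ω).nD s / N ω) l
      (𝓝 (p s * (q * f true s + (1 - q) * f false s))) := by
  simp only [ObsData.nD_div]
  have h := (H.tendsto true true s 0 (by simp)).add (H.tendsto true false s 0 (by simp))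
  convert h using 2
  simp only [if_true, if_false, Bool.false_eq_true, H.moment_zero_true]
  ring

theorem size_ne : ∀ᶠ ω in l, (N ω : ℝ) ≠ 0 :=
  H.size_pos.mono fun _ h => by exact_mod_cast h.ne'

theorem tendsto_nA_div_nS (s : 𝒮) : Tendsto (fun ω => (x ω).nA s / (x ω).nS s) l (𝓝 q) := by
  have hp := (H.p_pos s).ne'
  have h := (H.tendsto_nA s).div (H.tendsto_nS s) hp
  rw [mul_div_cancel_right₀ _ hp] at h
  exact h.congr' (H.size_ne.mono fun ω hω => div_div_div_cancel_right₀ hω _ _)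

theorem tendsto_nS_div_nA (s : 𝒮) : Tendsto (fun ω => (x ω).nS s / (x ω).nA s) l (𝓝 (1 / q)) := by
  have h := (H.tendsto_nA_div_nS s).inv₀ H.q_pos.ne'
  simpa only [inv_div, one_div] using h

theorem tendsto_nS_div_sub (s : 𝒮) :
    Tendsto (fun ω => (x ω).nS s / ((x ω).nS s - (x ω).nA s)) l (𝓝 (1 / (1 - q))) := by
  have hp := (H.p_pos s).ne'
  have hq : 1 - q ≠ 0 := (sub_pos.2 H.q_lt).ne'
  have h := (H.tendsto_nS s).div ((H.tendsto_nS s).sub (H.tendsto_nA s))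
    (by rw [← one_sub_mul]; exact mul_ne_zero hq hp)
  have h2 : p s / (p s - q * p s) = 1 / (1 - q) := by
    rw [← one_sub_mul]
    field_simp
  rw [h2] at h
  refine h.congr' (H.size_ne.mono fun ω hω => ?_)
  simp only [Pi.div_apply, ← sub_div]
  exact div_div_div_cancel_right₀ hω _ _

theorem tendsto_freqD1 (s : 𝒮) : Tendsto (fun ω => (x ω).freqD1 s) l (𝓝 (f true s)) := by
  have hp := (H.p_pos s).ne'
  have hq := H.q_pos.ne'
  have h := (H.tendsto_nAD s).div (H.tendsto_nA s) (mul_ne_zero hq hp)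
  have h2 : p s * q * f true s / (q * p s) = f true s := by field_simp
  rw [h2] at h
  exact h.congr' (H.size_ne.mono fun ω hω => div_div_div_cancel_right₀ hω _ _)

theorem tendsto_freqD0 (s : 𝒮) : Tendsto (fun ω => (x ω).freqD0 s) l (𝓝 (f false s)) := by
  have hp := (H.p_pos s).ne'
  have hq : 1 - q ≠ 0 := (sub_pos.2 H.q_lt).ne'
  have h := ((H.tendsto_nD s).sub (H.tendsto_nAD s)).div ((H.tendsto_nS s).sub (H.tendsto_nA s))
    (by rw [← one_sub_mul]; exact mul_ne_zero hq hp)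
  have h2 : (p s * (q * f true s + (1 - q) * f false s) - p s * q * f true s) / (p s - q * p s)
      = f false s := by
    rw [← one_sub_mul]
    field_simp
    ring
  rw [h2] at h
  refine h.congr' (H.size_ne.mono fun ω hω => ?_)
  simp only [Pi.div_apply, ← sub_div]
  exact div_div_div_cancel_right₀ hω _ _

theorem tendsto_det (s : 𝒮) :
    Tendsto (fun ω => (x ω).nS s / N ω * ((x ω).nAD s / N ω) - (x ω).nA s / N ω * ((x ω).nD s / N ω))
      l (𝓝 (p s ^ 2 * q * (1 - q) * (f true s - f false s))) := by
  have h := ((H.tendsto_nS s).mul (H.tendsto_nAD s)).sub ((H.tendsto_nA s).mul (H.tendsto_nD s))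
  convert h using 2
  ring

/-- Nonempty strata, a target share inside `(0, 1)` and the presence of compliers each contribute a
positive factor. -/
theorem det_limit_ne (s : 𝒮) : p s ^ 2 * q * (1 - q) * (f true s - f false s) ≠ 0 :=
  (mul_pos (mul_pos (mul_pos (pow_pos (H.p_pos s) 2) H.q_pos) (sub_pos.2 H.q_lt))
    (sub_pos.2 (H.f_lt s))).ne'

theorem tendsto_sum_Y (s : 𝒮) :
    Tendsto (fun ω => ((x ω).Zsatᵀ *ᵥ (x ω).Y) (Sum.inl s) / N ω) l
      (𝓝 (p s * (q * (g s + f true s * b s) + (1 - q) * (g s + f false s * b s)))) := by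
  simp only [ObsData.Zsat_transpose_mulVec_inl_div]
  have h := (((H.tendsto true true s 1 (by simp)).add (H.tendsto false true s 1 (by simp))).add
    (H.tendsto true false s 1 (by simp))).add (H.tendsto false false s 1 (by simp))
  convert h using 2
  simp only [if_true, if_false, Bool.false_eq_true, ← H.moment_one]
  ring

theorem tendsto_sum_AY (s : 𝒮) :
    Tendsto (fun ω => ((x ω).Zsatᵀ *ᵥ (x ω).Y) (Sum.inr s) / N ω) l
      (𝓝 (p s * (q * (g s + f true s * b s)))) := by
  simp only [ObsData.Zsat_transpose_mulVec_inr_div]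
  have h := (H.tendsto true true s 1 (by simp)).add (H.tendsto false true s 1 (by simp))
  convert h using 2
  simp only [if_true, ← H.moment_one]
  ring

variable [Fintype 𝒮]

theorem eventually_det_ne :
    ∀ᶠ ω in l, ∀ s, (x ω).nS s * (x ω).nAD s - (x ω).nA s * (x ω).nD s ≠ 0 := by
  rw [eventually_all]
  intro s
  filter_upwards [(H.tendsto_det s).eventually_ne (H.det_limit_ne s)] with ω hω hc
  refine hω ?_
  rw [div_mul_div_comm, div_mul_div_comm, ← sub_div, hc, zero_div]

/-- Cramer's rule in the limit: the arm means lie on the line with intercept `g s` and slope `b s`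
over the treatment frequencies `f a s`, and the two frequencies differ. -/
theorem tendsto_gammaSat (s : 𝒮) : Tendsto (fun ω => (x ω).gammaSat s) l (𝓝 (g s)) := by
  have h := (((H.tendsto_nAD s).mul (H.tendsto_sum_Y s)).sub
    ((H.tendsto_nD s).mul (H.tendsto_sum_AY s))).div (H.tendsto_det s) (H.det_limit_ne s)
  have hg : (p s * q * f true s *
      (p s * (q * (g s + f true s * b s) + (1 - q) * (g s + f false s * b s)))
      - p s * (q * f true s + (1 - q) * f false s) * (p s * (q * (g s + f true s * b s))))
      / (p s ^ 2 * q * (1 - q) * (f true s - f false s)) = g s := by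
    rw [div_eq_iff (H.det_limit_ne s)]
    ring
  rw [hg] at h
  refine h.congr' ?_
  filter_upwards [H.size_ne, H.eventually_det_ne] with ω hN hdet
  rw [ObsData.gammaSat_eq _ hdet]
  simp only [Pi.div_apply, div_mul_div_comm, ← sub_div]
  exact div_div_div_cancel_right₀ (mul_ne_zero hN hN) _ _

theorem tendsto_betaSat (s : 𝒮) : Tendsto (fun ω => (x ω).betaSat s) l (𝓝 (b s)) := by
  have h := (((H.tendsto_nS s).mul (H.tendsto_sum_AY s)).sub
    ((H.tendsto_nA s).mul (H.tendsto_sum_Y s))).div (H.tendsto_det s) (H.det_limit_ne s)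
  have hb : (p s * (p s * (q * (g s + f true s * b s)))
      - q * p s * (p s * (q * (g s + f true s * b s) + (1 - q) * (g s + f false s * b s))))
      / (p s ^ 2 * q * (1 - q) * (f true s - f false s)) = b s := by
    rw [div_eq_iff (H.det_limit_ne s)]
    ring
  rw [hb] at h
  refine h.congr' ?_
  filter_upwards [H.size_ne, H.eventually_det_ne] with ω hN hdet
  rw [ObsData.betaSat_eq _ hdet]
  simp only [Pi.div_apply, div_mul_div_comm, ← sub_div]
  exact div_div_div_cancel_right₀ (mul_ne_zero hN hN) _ _

theorem tendsto_PhatC :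
    Tendsto (fun ω => (x ω).PhatC) l (𝓝 (∑ s, p s * (f true s - f false s))) :=
  tendsto_finsetSum _ fun s _ =>
    (H.tendsto_nS s).mul ((H.tendsto_freqD1 s).sub (H.tendsto_freqD0 s))

theorem sum_pos [Nonempty 𝒮] : 0 < ∑ s, p s * (f true s - f false s) :=
  Finset.sum_pos (fun s _ => mul_pos (H.p_pos s) (sub_pos.2 (H.f_lt s))) Finset.univ_nonempty

theorem tendsto_betaSatLate [Nonempty 𝒮] {P : ℝ} (hP : ∑ s, p s * (f true s - f false s) = P) :
    Tendsto (fun ω => (x ω).betaSatLate) l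
      (𝓝 (∑ s, p s * (f true s - f false s) / P * b s)) := by
  subst hP
  exact tendsto_finsetSum _ fun s _ => (((H.tendsto_nS s).mul
    ((H.tendsto_freqD1 s).sub (H.tendsto_freqD0 s))).div H.tendsto_PhatC
      H.sum_pos.ne').mul (H.tendsto_betaSat s)

theorem tendsto_cellSq (d a : Bool) (s : 𝒮) {c : α → ℝ} {c₀ : ℝ} (hc : Tendsto c l (𝓝 c₀)) :
    Tendsto (fun ω => (x ω).cellSq d a s (c ω)) l
      (𝓝 (p s * (if a then q else 1 - q) * (e d a s 2 + 2 * (c₀ - g s - bit d * b s) * e d a s 1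
        + (c₀ - g s - bit d * b s) ^ 2 * e d a s 0))) := by
  simp only [ObsData.cellSq_eq]
  have hr := (hc.sub (H.tendsto_gammaSat s)).sub ((H.tendsto_betaSat s).const_mul (bit d))
  have h := ((H.tendsto d a s 2 le_rfl).add ((hr.const_mul 2).mul
    (H.tendsto d a s 1 (by simp)))).add ((hr.pow 2).mul (H.tendsto d a s 0 (by simp)))
  convert h using 2
  ring

/-! ### Limits of the components of the variance estimator -/

variable {P β : ℝ}

theorem tendsto_Vhat1 [Nonempty 𝒮] (hP : ∑ s, p s * (f true s - f false s) = P)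
    (hβ : ∑ s, p s * (f true s - f false s) / P * b s = β) :
    Tendsto (fun ω => (x ω).Vhat1) l (𝓝 (1 / P ^ 2 * ∑ s, p s / q *
      ((e true true s 2
          + 2 * ((1 - f true s) * (b s - β) - g s - b s) * e true true s 1
          + ((1 - f true s) * (b s - β) - g s - b s) ^ 2 * f true s)
        + (e false true s 2
          + 2 * (-(f true s * (b s - β)) - g s) * e false true s 1
          + (-(f true s * (b s - β)) - g s) ^ 2 * (1 - f true s))))) := by
  have hq := H.q_pos.ne'
  have hPC := H.tendsto_PhatC
  have hL := H.tendsto_betaSatLate hP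
  have hPne := H.sum_pos.ne'
  rw [hβ] at hL
  rw [hP] at hPC hPne
  have h := ((tendsto_const_nhds (x := (1 : ℝ))).div (hPC.pow 2) (pow_ne_zero 2 hPne)).mul
    (tendsto_finsetSum (s := (Finset.univ : Finset 𝒮)) fun s _ =>
    ((H.tendsto_nS_div_nA s).pow 2).mul ((H.tendsto_cellSq true true s
      (((tendsto_const_nhds (x := (1 : ℝ))).sub (H.tendsto_freqD1 s)).mul
        ((H.tendsto_betaSat s).sub hL))).add
      (H.tendsto_cellSq false true s ((H.tendsto_freqD1 s).mul
        ((H.tendsto_betaSat s).sub hL)).neg)))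
  refine tendsto_nhds_of_eq h ?_
  congr 1
  -- The factor `(1 / q) ^ 2` meets the cell weight `p s * q`, leaving `p s / q`.
  refine Finset.sum_congr rfl fun s _ => ?_
  simp only [if_true, H.moment_zero_true, H.moment_zero_false, bit, Bool.false_eq_true, if_false]
  field_simp
  ring

theorem tendsto_Vhat0 [Nonempty 𝒮] (hP : ∑ s, p s * (f true s - f false s) = P)
    (hβ : ∑ s, p s * (f true s - f false s) / P * b s = β) :
    Tendsto (fun ω => (x ω).Vhat0) l (𝓝 (1 / P ^ 2 * ∑ s, p s / (1 - q) *
      ((e true false s 2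
          + 2 * ((1 - f false s) * (b s - β) - g s - b s) * e true false s 1
          + ((1 - f false s) * (b s - β) - g s - b s) ^ 2 * f false s)
        + (e false false s 2
          + 2 * (-(f false s * (b s - β)) - g s) * e false false s 1
          + (-(f false s * (b s - β)) - g s) ^ 2 * (1 - f false s))))) := by
  have hq : 1 - q ≠ 0 := (sub_pos.2 H.q_lt).ne'
  have hPC := H.tendsto_PhatC
  have hL := H.tendsto_betaSatLate hP
  have hPne := H.sum_pos.ne'
  rw [hβ] at hL
  rw [hP] at hPC hPne
  have h := ((tendsto_const_nhds (x := (1 : ℝ))).div (hPC.pow 2) (pow_ne_zero 2 hPne)).mul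
    (tendsto_finsetSum (s := (Finset.univ : Finset 𝒮)) fun s _ =>
    ((H.tendsto_nS_div_sub s).pow 2).mul ((H.tendsto_cellSq true false s
      (((tendsto_const_nhds (x := (1 : ℝ))).sub (H.tendsto_freqD0 s)).mul
        ((H.tendsto_betaSat s).sub hL))).add
      (H.tendsto_cellSq false false s ((H.tendsto_freqD0 s).mul
        ((H.tendsto_betaSat s).sub hL)).neg)))
  refine tendsto_nhds_of_eq h ?_
  congr 1
  refine Finset.sum_congr rfl fun s _ => ?_
  simp only [if_true, H.moment_zero_true, H.moment_zero_false, bit, Bool.false_eq_true, if_false]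
  field_simp
  ring

theorem tendsto_VhatH [Nonempty 𝒮] (hP : ∑ s, p s * (f true s - f false s) = P)
    (hβ : ∑ s, p s * (f true s - f false s) / P * b s = β) :
    Tendsto (fun ω => (x ω).VhatH) l (𝓝 (1 / P ^ 2 *
      ∑ s, p s * (f true s - f false s) ^ 2 * (b s - β) ^ 2)) := by
  have hPC := H.tendsto_PhatC
  have hL := H.tendsto_betaSatLate hP
  have hPne := H.sum_pos.ne'
  rw [hβ] at hL
  rw [hP] at hPC hPne
  exact (tendsto_const_nhds.div (hPC.pow 2) (pow_ne_zero 2 hPne)).mul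
    (tendsto_finsetSum _ fun s _ => ((H.tendsto_nS s).mul
      (((H.tendsto_freqD1 s).sub (H.tendsto_freqD0 s)).pow 2)).mul
        (((H.tendsto_betaSat s).sub hL).pow 2))

theorem tendsto_VhatA2s [Nonempty 𝒮] (hP : ∑ s, p s * (f true s - f false s) = P)
    (hβ : ∑ s, p s * (f true s - f false s) / P * b s = β) (tau : 𝒮 → ℝ) {r : α → 𝒮 → ℝ}
    (hr : ∀ s, Tendsto (fun ω => r ω s) l (𝓝 (p s))) :
    Tendsto (fun ω => (x ω).VhatA2s tau (r ω)) l
      (𝓝 (∑ s, p s * tau s / (q * (1 - q) * P ^ 2) *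
        ((q * f false s + (1 - q) * f true s) * (b s - β) + g s
          - ∑ t, p t * ((q * f true t + (1 - q) * f false t) * (b t - β) + g t)) ^ 2)) := by
  have hq := H.q_pos.ne'
  have hq' : 1 - q ≠ 0 := (sub_pos.2 H.q_lt).ne'
  have hPC := H.tendsto_PhatC
  have hL := H.tendsto_betaSatLate hP
  have hPne := H.sum_pos.ne'
  rw [hβ] at hL
  rw [hP] at hPC hPne
  have hδ := fun s => (H.tendsto_betaSat s).sub hL
  have hone := fun s => (tendsto_const_nhds (x := (1 : ℝ))).sub (H.tendsto_nA_div_nS s)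
  have h := tendsto_finsetSum (s := (Finset.univ : Finset 𝒮)) fun s _ =>
    (((H.tendsto_nS s).mul_const (tau s)).div
      (((H.tendsto_nA_div_nS s).mul (hone s)).mul (hPC.pow 2))
      (mul_ne_zero (mul_ne_zero hq hq') (pow_ne_zero 2 hPne))).mul
    (((((((H.tendsto_nA_div_nS s).mul (H.tendsto_freqD0 s)).add
      ((hone s).mul (H.tendsto_freqD1 s))).mul (hδ s)).sub
      (tendsto_finsetSum (s := (Finset.univ : Finset 𝒮)) fun t _ =>
        (H.tendsto_nD t).mul (hδ t))).add (H.tendsto_gammaSat s)).sub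
      (tendsto_finsetSum (s := (Finset.univ : Finset 𝒮)) fun t _ =>
        (hr t).mul (H.tendsto_gammaSat t)) |>.pow 2)
  refine tendsto_nhds_of_eq h (Finset.sum_congr rfl fun s _ => ?_)
  -- The limit of `n_D(t) / n` is `p t * (q * f true t + (1 - q) * f false t)`, so the two
  -- subtracted sums merge into the single centring sum of the target.
  simp only [mul_add, Finset.sum_add_distrib, ← mul_assoc]
  ring

end CellLimits

/-! ### Moments of the population -/

theorem MeasureTheory.MemLp.cond {Ω : Type*} [MeasurableSpace Ω] {μ : Measure Ω}
    {f : Ω → ℝ} {p : ENNReal} (hf : MemLp f p μ) (B : Set Ω) : MemLp f p μ[|B] := by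
  by_cases h : μ B = 0
  · have : μ[|B] = 0 := cond_eq_zero_of_meas_eq_zero h
    rw [this]
    exact ⟨aestronglyMeasurable_zero_measure f, by simp⟩
  · exact (hf.restrict B).smul_measure (ENNReal.inv_ne_top.2 h)

section Moments

variable {𝒵 𝒮 : Type*}

namespace Participant

theorem D_true_true_eq : {w : Participant 𝒵 | w.D true = true} = AT ∪ C := by
  ext w
  change w.D true = true ↔
    (w.D false = true ∧ w.D true = true) ∨ (w.D false = false ∧ w.D true = true)
  cases w.D false <;> simp

theorem D_false_false_eq : {w : Participant 𝒵 | w.D false = false} = C ∪ NT := by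
  ext w
  change w.D false = false ↔
    (w.D false = false ∧ w.D true = true) ∨ (w.D false = false ∧ w.D true = false)
  cases w.D true <;> simp

theorem disjoint_AT_C : Disjoint (AT : Set (Participant 𝒵)) C :=
  Set.disjoint_left.2 fun _ h1 h2 => Bool.noConfusion (h1.1.symm.trans h2.1)

theorem disjoint_C_NT : Disjoint (C : Set (Participant 𝒵)) NT :=
  Set.disjoint_left.2 fun _ h1 h2 => Bool.noConfusion (h1.2.symm.trans h2.2)

end Participant

variable [MeasurableSpace 𝒵]

namespace Participant

theorem measurable_D (a : Bool) : Measurable fun w : Participant 𝒵 => w.D a :=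
  (measurable_pi_apply a).comp (measurable_fst.comp measurable_snd)

theorem measurableSet_D (a d : Bool) : MeasurableSet {w : Participant 𝒵 | w.D a = d} :=
  measurable_D a (measurableSet_singleton d)

theorem measurableSet_C : MeasurableSet (C : Set (Participant 𝒵)) :=
  (measurableSet_D false false).inter (measurableSet_D true true)

theorem measurableSet_AT : MeasurableSet (AT : Set (Participant 𝒵)) :=
  (measurableSet_D false true).inter (measurableSet_D true true)

theorem measurableSet_NT : MeasurableSet (NT : Set (Participant 𝒵)) :=
  (measurableSet_D false false).inter (measurableSet_D true false)

theorem ae_D_le {μ : Measure (Participant 𝒵)} (h : μ DEF = 0) :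
    ∀ᵐ w ∂μ, ¬ (w.D false = true ∧ w.D true = false) :=
  measure_eq_zero_iff_ae_notMem.1 h

theorem D_true_false_ae {μ : Measure (Participant 𝒵)} (h : μ DEF = 0) :
    {w : Participant 𝒵 | w.D true = false} =ᵐ[μ] NT := by
  filter_upwards [ae_D_le h] with w hw
  refine propext (show w.D true = false ↔ w.D false = false ∧ w.D true = false from ?_)
  cases hf : w.D false <;> simp_all

theorem D_false_true_ae {μ : Measure (Participant 𝒵)} (h : μ DEF = 0) :
    {w : Participant 𝒵 | w.D false = true} =ᵐ[μ] AT := by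
  filter_upwards [ae_D_le h] with w hw
  refine propext (show w.D false = true ↔ w.D false = true ∧ w.D true = true from ?_)
  cases hf : w.D true <;> simp_all

end Participant

open Participant

/-- `E[Y(d)^k I{D(a) = d} | S = s]`. -/
def armMoment (Q : Measure (Participant 𝒵)) (S : 𝒵 → 𝒮) (d a : Bool) (s : 𝒮) (k : ℕ) : ℝ :=
  ∫ w in {w : Participant 𝒵 | w.D a = d}, w.Y d ^ k ∂Q[|inStratum S s]

variable {S : 𝒵 → 𝒮} {Q : Measure (Participant 𝒵)}

theorem cond_inter_inStratum [IsProbabilityMeasure Q] [MeasurableSpace 𝒮] [MeasurableSingletonClass 𝒮]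
    (hS : Measurable S) {T : Set (Participant 𝒵)} (hT : MeasurableSet T)
    (s : 𝒮) : Q[|T ∩ inStratum S s] = (Q[|inStratum S s])[|T] := by
  rw [Set.inter_comm, cond_cond_eq_cond_inter (measurableSet_inStratum hS s) hT]

theorem setIntegral_Y_eq [IsProbabilityMeasure Q] [MeasurableSpace 𝒮] [MeasurableSingletonClass 𝒮]
    (hS : Measurable S) {T : Set (Participant 𝒵)} (hT : MeasurableSet T)
    (d : Bool) (s : 𝒮) :
    ∫ w in T, w.Y d ∂Q[|inStratum S s] = (Q[|inStratum S s]).real T * condMean Q S d T s := by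
  rw [setIntegral_eq_real_mul_integral_cond, condMean, cond_inter_inStratum hS hT]

theorem setIntegral_Y_sq_eq [IsProbabilityMeasure Q] [MeasurableSpace 𝒮] [MeasurableSingletonClass 𝒮]
    (hS : Measurable S) {T : Set (Participant 𝒵)} (hT : MeasurableSet T)
    {d : Bool} (hY : MemLp (fun w : Participant 𝒵 => w.Y d) 2 Q) (s : 𝒮) :
    ∫ w in T, w.Y d ^ 2 ∂Q[|inStratum S s]
      = (Q[|inStratum S s]).real T * (condVariance Q S d T s + condMean Q S d T s ^ 2) := by
  rw [setIntegral_eq_real_mul_integral_cond, condMean, condVariance, cond_inter_inStratum hS hT]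
  -- For a null type the factor in front is zero, whatever value the conditional variance takes;
  -- otherwise conditioning gives a probability measure and the usual variance formula applies.
  by_cases h : Q[|inStratum S s] T = 0
  · simp [measureReal_def, h]
  have : IsProbabilityMeasure (Q[|inStratum S s])[|T] := cond_isProbabilityMeasure h
  rw [variance_eq_sub ((hY.cond _).cond _)]
  simp

theorem lateS_eq [IsProbabilityMeasure Q]
    (hY : ∀ d, MemLp (fun w : Participant 𝒵 => w.Y d) 2 Q) (s : 𝒮) :
    lateS Q S s = condMean Q S true C s - condMean Q S false C s :=
  integral_sub (((hY true).integrable one_le_two).cond _) (((hY false).integrable one_le_two).cond _)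

theorem cond_DEF_eq_zero (hdef : Q DEF = 0) (s : 𝒮) : Q[|inStratum S s] DEF = 0 :=
  cond_absolutelyContinuous hdef

theorem real_AT (hdef : Q DEF = 0) (s : 𝒮) :
    (Q[|inStratum S s]).real AT = piD Q S false s :=
  (measureReal_congr (D_false_true_ae (cond_DEF_eq_zero hdef s))).symm

/-- Always takers and compliers together are those with `D(1) = 1`, and without defiers the always
takers are almost surely those with `D(0) = 1`. -/
theorem real_C [IsProbabilityMeasure Q]
    (hdef : Q DEF = 0) (s : 𝒮) :
    (Q[|inStratum S s]).real C = piD Q S true s - piD Q S false s := by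
  rw [← real_AT hdef, piD, D_true_true_eq, measureReal_union disjoint_AT_C measurableSet_C]
  ring

theorem real_NT [IsProbabilityMeasure Q]
    (hdef : Q DEF = 0) {s : 𝒮} (hs : 0 < pS Q S s) :
    (Q[|inStratum S s]).real NT = 1 - piD Q S true s := by
  have : IsProbabilityMeasure Q[|inStratum S s] :=
    cond_isProbabilityMeasure fun h => hs.ne' (by simp [pS, measureReal_def, h])
  rw [← measureReal_congr (D_true_false_ae (cond_DEF_eq_zero hdef s)), piD,
    ← probReal_compl_eq_one_sub (measurableSet_D true true)]
  congr 1
  ext w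
  simp

theorem integrable_Y_pow [IsProbabilityMeasure Q]
    (hY : ∀ d, MemLp (fun w : Participant 𝒵 => w.Y d) 2 Q) (d : Bool)
    {k : ℕ} (hk : k ≤ 2) : Integrable (fun w : Participant 𝒵 => w.Y d ^ k) Q := by
  interval_cases k
  · simp
  · simpa using (hY d).integrable one_le_two
  · exact (hY d).integrable_sq

theorem armMoment_true_false (hdef : Q DEF = 0) (s : 𝒮) (k : ℕ) :
    armMoment Q S true false s k = ∫ w in AT, w.Y true ^ k ∂Q[|inStratum S s] :=
  setIntegral_congr_set (D_false_true_ae (cond_DEF_eq_zero hdef s))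

theorem armMoment_false_true (hdef : Q DEF = 0) (s : 𝒮) (k : ℕ) :
    armMoment Q S false true s k = ∫ w in NT, w.Y false ^ k ∂Q[|inStratum S s] :=
  setIntegral_congr_set (D_true_false_ae (cond_DEF_eq_zero hdef s))

/-- The treated in the treatment arm mix two types, which is the origin of the between-type term in
`VsatY1`. This decomposition holds even with defiers, unlike the single-type formulas for `armMoment
S true false` and its mirror image. -/
theorem armMoment_true_true [IsProbabilityMeasure Q]
    (hY : ∀ d, MemLp (fun w : Participant 𝒵 => w.Y d) 2 Q) (s : 𝒮)
    {k : ℕ} (hk : k ≤ 2) :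
    armMoment Q S true true s k = ∫ w in AT, w.Y true ^ k ∂Q[|inStratum S s]
      + ∫ w in C, w.Y true ^ k ∂Q[|inStratum S s] := by
  have hint := (integrable_Y_pow hY true hk).cond (inStratum S s)
  rw [armMoment, D_true_true_eq, setIntegral_union disjoint_AT_C measurableSet_C
    hint.integrableOn hint.integrableOn]

theorem armMoment_false_false [IsProbabilityMeasure Q]
    (hY : ∀ d, MemLp (fun w : Participant 𝒵 => w.Y d) 2 Q) (s : 𝒮)
    {k : ℕ} (hk : k ≤ 2) :
    armMoment Q S false false s k = ∫ w in C, w.Y false ^ k ∂Q[|inStratum S s]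
      + ∫ w in NT, w.Y false ^ k ∂Q[|inStratum S s] := by
  have hint := (integrable_Y_pow hY false hk).cond (inStratum S s)
  rw [armMoment, D_false_false_eq, setIntegral_union disjoint_C_NT measurableSet_NT
    hint.integrableOn hint.integrableOn]

theorem armMoment_zero (d a : Bool) (s : 𝒮) :
    armMoment Q S d a s 0 = (Q[|inStratum S s]).real {w : Participant 𝒵 | w.D a = d} := by
  simp [armMoment]

theorem armMoment_zero_false [IsProbabilityMeasure Q]
    (a : Bool) {s : 𝒮} (hs : 0 < pS Q S s) :
    armMoment Q S false a s 0 = 1 - piD Q S a s := by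
  have : IsProbabilityMeasure Q[|inStratum S s] :=
    cond_isProbabilityMeasure fun h => hs.ne' (by simp [pS, measureReal_def, h])
  rw [armMoment_zero, piD, ← probReal_compl_eq_one_sub (measurableSet_D a true)]
  congr 1
  ext w
  simp

/-- This is what `gammaS` is designed for. Going from control to treatment changes the outcome of
compliers alone, by `lateS` on average, on a fraction `π_{D(1)} - π_{D(0)}`. Both arm means are thus
affine in `π_{D(a)}` with slope `lateS` and a common intercept. -/
theorem armMoment_one_add [IsProbabilityMeasure Q] [MeasurableSpace 𝒮] [MeasurableSingletonClass 𝒮]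
    (hS : Measurable S)
    (hY : ∀ d, MemLp (fun w : Participant 𝒵 => w.Y d) 2 Q) (hdef : Q DEF = 0) (a : Bool) {s : 𝒮}
    (hs : 0 < pS Q S s) :
    armMoment Q S true a s 1 + armMoment Q S false a s 1
      = gammaS Q S s + piD Q S a s * lateS Q S s := by
  rw [lateS_eq hY, gammaS]
  cases a
  · rw [armMoment_true_false hdef, armMoment_false_false hY s (by simp)]
    simp only [pow_one]
    rw [setIntegral_Y_eq hS measurableSet_AT, setIntegral_Y_eq hS measurableSet_C,
      setIntegral_Y_eq hS measurableSet_NT, real_AT hdef, real_C hdef, real_NT hdef hs]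
    ring
  · rw [armMoment_false_true hdef, armMoment_true_true hY s (by simp)]
    simp only [pow_one]
    rw [setIntegral_Y_eq hS measurableSet_AT, setIntegral_Y_eq hS measurableSet_C,
      setIntegral_Y_eq hS measurableSet_NT, real_AT hdef, real_C hdef, real_NT hdef hs]
    ring

/-! ### Averaging the complier effect over the strata -/

theorem real_C_inter [IsProbabilityMeasure Q] [MeasurableSpace 𝒮] [MeasurableSingletonClass 𝒮]
    (hS : Measurable S) (hdef : Q DEF = 0) (s : 𝒮) :
    Q.real (C ∩ inStratum S s) = pS Q S s * (piD Q S true s - piD Q S false s) := by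
  rw [← real_C hdef, pS, Set.inter_comm, measureReal_def, measureReal_def, measureReal_def,
    ← ENNReal.toReal_mul, mul_comm, cond_mul_eq_inter (measurableSet_inStratum hS s)]

theorem setIntegral_C_eq [Fintype 𝒮] [MeasurableSpace 𝒮] [MeasurableSingletonClass 𝒮]
    (hS : Measurable S) {f : Participant 𝒵 → ℝ} (hf : Integrable f Q) :
    ∫ w in C, f w ∂Q = ∑ s, ∫ w in C ∩ inStratum S s, f w ∂Q := by
  have hU : (C : Set (Participant 𝒵)) = ⋃ s, C ∩ inStratum S s := by
    rw [← Set.inter_iUnion]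
    ext w
    simp [inStratum]
  conv_lhs => rw [hU]
  exact integral_iUnion_fintype
    (fun s => measurableSet_C.inter (measurableSet_inStratum hS s))
    (fun s t hst => Set.disjoint_left.2 fun w h1 h2 => hst (h1.2.symm.trans h2.2))
    fun s => hf.integrableOn

theorem real_C_eq_probC [IsProbabilityMeasure Q] [Fintype 𝒮] [MeasurableSpace 𝒮] [MeasurableSingletonClass 𝒮]
    (hS : Measurable S) (hdef : Q DEF = 0) : Q.real C = probC Q S := by
  have h := setIntegral_C_eq (Q := Q) hS (integrable_const 1)
  simp only [setIntegral_const, smul_eq_mul, mul_one, real_C_inter hS hdef] at h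
  exact h

theorem sum_lateS_eq_late [IsProbabilityMeasure Q] [Fintype 𝒮] [MeasurableSpace 𝒮] [MeasurableSingletonClass 𝒮]
    (hS : Measurable S)
    (hY : ∀ d, MemLp (fun w : Participant 𝒵 => w.Y d) 2 Q) (hdef : Q DEF = 0)
    (hP : probC Q S ≠ 0) :
    ∑ s, pS Q S s * (piD Q S true s - piD Q S false s) / probC Q S * lateS Q S s = late Q := by
  have hint : Integrable (fun w : Participant 𝒵 => w.Y true - w.Y false) Q :=
    ((hY true).integrable one_le_two).sub ((hY false).integrable one_le_two)
  have h := setIntegral_C_eq (Q := Q) hS hint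
  simp only [setIntegral_eq_real_mul_integral_cond, real_C_inter hS hdef,
    real_C_eq_probC hS hdef] at h
  have h' : probC Q S * late Q
      = ∑ s, pS Q S s * (piD Q S true s - piD Q S false s) * lateS Q S s := h
  rw [eq_comm, ← mul_right_inj' hP, h', Finset.mul_sum]
  refine Finset.sum_congr rfl fun s _ => ?_
  field_simp

end Moments

/-! ### The asymptotic variance in terms of the moments of the arms -/

/-- An analysis of variance. The left side is the second moment of the adjusted residual in the arm,
whose mean is zero. Within `D = 1` it has the type variances plus the between-type term `p0 (p1 -
p0) / p1 * (m1C - m1A) ^ 2`. The means of the residual for `D = 1` and `D = 0` differ by the last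
bracket divided by `p1`, which contributes its square times `p1 (1 - p1)`. -/
theorem treated_arm_variance_identity {p0 p1 m1A m1C m0C m0N v1A v1C v0N δ p q g : ℝ}
    (hp1 : p1 ≠ 0) (hq : q ≠ 0) (hg : g = p1 * m0C - p0 * m1C + p0 * m1A + (1 - p1) * m0N) :
    p / q * ((p0 * (v1A + m1A ^ 2) + (p1 - p0) * (v1C + m1C ^ 2)
          + 2 * ((1 - p1) * δ - g - (m1C - m0C)) * (p0 * m1A + (p1 - p0) * m1C)
          + ((1 - p1) * δ - g - (m1C - m0C)) ^ 2 * p1)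
        + ((1 - p1) * (v0N + m0N ^ 2) + 2 * (-(p1 * δ) - g) * ((1 - p1) * m0N)
          + (-(p1 * δ) - g) ^ 2 * (1 - p1)))
      = p / q * (v1A * p0 + v0N * (1 - p1) + v1C * (p1 - p0)
          + (m1C - m1A) ^ 2 * (p0 * (p1 - p0) / p1))
        + p * (1 - p1) / (q * p1) * (-p0 * (m1C - m1A) + p1 * (m0C - m0N) + p1 * δ) ^ 2 := by
  subst hg
  field_simp
  ring

/-- The mirror image: here the untreated mix compliers and never takers, and the gap between the two
decisions is the last bracket divided by `1 - p0`. It is applied with `q` equal to one minus the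
target share. -/
theorem control_arm_variance_identity {p0 p1 m1A m1C m0C m0N v1A v0C v0N δ p q g : ℝ}
    (hp0 : 1 - p0 ≠ 0) (hq : q ≠ 0) (hg : g = p1 * m0C - p0 * m1C + p0 * m1A + (1 - p1) * m0N) :
    p / q * ((p0 * (v1A + m1A ^ 2)
          + 2 * ((1 - p0) * δ - g - (m1C - m0C)) * (p0 * m1A)
          + ((1 - p0) * δ - g - (m1C - m0C)) ^ 2 * p0)
        + ((p1 - p0) * (v0C + m0C ^ 2) + (1 - p1) * (v0N + m0N ^ 2)
          + 2 * (-(p0 * δ) - g) * ((p1 - p0) * m0C + (1 - p1) * m0N)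
          + (-(p0 * δ) - g) ^ 2 * (1 - p0)))
      = p / q * (v1A * p0 + v0N * (1 - p1) + v0C * (p1 - p0)
          + (m0C - m0N) ^ 2 * ((1 - p1) * (p1 - p0) / (1 - p0)))
        + p * p0 / (q * (1 - p0)) *
          (-(1 - p0) * (m1C - m1A) + (1 - p1) * (m0C - m0N) + (1 - p0) * δ) ^ 2 := by
  subst hg
  field_simp
  ring

/-! ### Limits in probability of the cell averages -/

section CellAverages

variable {𝒵 𝒮 : Type*} [MeasurableSpace 𝒵] [Fintype 𝒮] [DecidableEq 𝒮] [MeasurableSpace 𝒮]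
  [MeasurableSingletonClass 𝒮] {S : 𝒵 → 𝒮} {Q : Measure (Participant 𝒵)} [IsProbabilityMeasure Q]
  {Ω : ℕ → Type*} [∀ n, MeasurableSpace (Ω n)] {μ : ∀ n, Measure (Ω n)}
  [∀ n, IsProbabilityMeasure (μ n)] {W : ∀ n, Ω n → Fin n → Participant 𝒵}
  {A : ∀ n, Ω n → Fin n → Bool} {piA : ℝ} {tau : 𝒮 → ℝ}

-- Only the tightness contained in the conditional limit law matters here; the covariance plays no
-- role, and `tau` enters the estimator merely as known weights.
omit [IsProbabilityMeasure Q] in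
theorem tendsto_assigned_share (hS : Measurable S) (h1 : SamplingAssumption μ W Q S)
    (h3 : AssignmentAssumption μ W A Q S piA tau) (s : 𝒮) :
    Tendsto (fun x : Σ n, Ω n => (observe S (W x.1 x.2) (A x.1 x.2)).nA s
      / (observe S (W x.1 x.2) (A x.1 x.2)).nS s) (probFilter μ) (𝓝 piA) := by
  refine h3.balance.tendsto_probFilter
    (R := fun n ω s => (observe S (W n ω) (A n ω)).nA s / (observe S (W n ω) (A n ω)).nS s)
    (fun n t => measurableSet_strata hS (h1.measurable_sample n) t) (fun n => ?_) s
  have hSi : ∀ i, Measurable fun ω => S (W n ω i).Z := fun i =>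
    (measurable_stratum hS).comp ((measurable_pi_apply i).comp (h1.measurable_sample n))
  have hAi : ∀ i, Measurable fun ω => A n ω i := fun i =>
    (measurable_pi_apply i).comp (h3.measurable_assignment n)
  refine measurable_pi_lambda _ fun s => Measurable.div ?_ ?_
  · exact Finset.measurable_fun_sum _ fun i _ => Measurable.ite
      ((hAi i (measurableSet_singleton true)).inter (hSi i (measurableSet_singleton s)))
      measurable_const measurable_const
  · exact Finset.measurable_fun_sum _ fun i _ => Measurable.ite
      (hSi i (measurableSet_singleton s)) measurable_const measurable_const

theorem tendsto_arm_share (hS : Measurable S) (h1 : SamplingAssumption μ W Q S)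
    (h3 : AssignmentAssumption μ W A Q S piA tau) (a : Bool) (s : 𝒮) :
    Tendsto (fun x : Σ n, Ω n => 1 / (x.1 : ℝ) *
      ∑ i, if A x.1 x.2 i = a ∧ S (W x.1 x.2 i).Z = s then (1 : ℝ) else 0)
      (probFilter μ) (𝓝 (pS Q S s * if a then piA else 1 - piA)) := by
  have hN := tendsto_stratum_frequency (A := A) hS h1.measurable_sample h1.iid s
  have hA : Tendsto (fun x : Σ n, Ω n => (observe S (W x.1 x.2) (A x.1 x.2)).nA s / x.1)
      (probFilter μ) (𝓝 (pS Q S s * piA)) := by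
    refine (hN.mul (tendsto_assigned_share hS h1 h3 s)).congr' ?_
    -- The product of the two ratios equals `n_A(s) / n` only where `n(s) ≠ 0`, which holds
    -- eventually because `p(s) > 0`.
    filter_upwards [hN.eventually_ne (h1.strata_pos s).ne'] with x hx
    have hx' : (observe S (W x.1 x.2) (A x.1 x.2)).nS s ≠ 0 := fun h => hx (by rw [h, zero_div])
    field_simp
  cases a
  · have h := hN.sub hA
    rw [← mul_one_sub] at h
    simp only [Bool.false_eq_true, if_false]
    refine h.congr fun x => ?_
    rw [← sub_div, one_div_mul_eq_div, ObsData.nS, ObsData.nA, ← Finset.sum_sub_distrib]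
    congr 1
    refine Finset.sum_congr rfl fun i _ => ?_
    by_cases hs : S (W x.1 x.2 i).Z = s <;> cases ha : A x.1 x.2 i <;> simp [observe, hs, ha]
  · simp only [if_true]
    refine hA.congr fun x => ?_
    rw [one_div_mul_eq_div]
    rfl

/-- For an individual in arm `a` the observed indicator and outcome coincide with those of the
function `g` of the participant alone. Subtracting the stratum mean of `g` leaves a negligible
average, and the mean is multiplied by the share of the arm. -/
theorem tendsto_cellMoment (hS : Measurable S) (h1 : SamplingAssumption μ W Q S)
    (h3 : AssignmentAssumption μ W A Q S piA tau) (d a : Bool) (s : 𝒮) {k : ℕ} (hk : k ≤ 2) :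
    Tendsto (fun x : Σ n, Ω n => (observe S (W x.1 x.2) (A x.1 x.2)).cellMoment d a s k)
      (probFilter μ) (𝓝 (pS Q S s * (if a then piA else 1 - piA) * armMoment Q S d a s k)) := by
  set g : Participant 𝒵 → ℝ := {w : Participant 𝒵 | w.D a = d}.indicator fun w => w.Y d ^ k
    with hg
  have hgi : Integrable g Q :=
    (integrable_Y_pow h1.sq_integrable d hk).indicator (Participant.measurableSet_D a d)
  have hmean : ∫ w, g w ∂Q[|inStratum S s] = armMoment Q S d a s k :=
    integral_indicator (Participant.measurableSet_D a d)
  have hcen := tendsto_average_centered hS h1.measurable_sample h1.iid h3.measurable_assignment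
    h3.cond_indep s hgi (b := fun c => if c = a then 1 else 0)
    (fun c => by split_ifs <;> simp)
  have h := hcen.add ((tendsto_arm_share hS h1 h3 a s).mul_const (armMoment Q S d a s k))
  rw [zero_add] at h
  refine h.congr fun x => ?_
  rw [ObsData.cellMoment, mul_assoc, ← mul_add, Finset.sum_mul, ← Finset.sum_add_distrib]
  congr 1
  refine Finset.sum_congr rfl fun i _ => ?_
  rw [centered, hmean]
  simp only [Set.indicator_apply, hg, inStratum, observe, Set.mem_ofPred_eq]
  by_cases hs : S (W x.1 x.2 i).Z = s <;> by_cases ha : A x.1 x.2 i = a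
  · subst ha
    by_cases hd : (W x.1 x.2 i).D (A x.1 x.2 i) = d <;> simp [hs, hd]
  all_goals simp [hs, ha]

theorem cellLimits_observe (hS : Measurable S) (h1 : SamplingAssumption μ W Q S)
    (h3 : AssignmentAssumption μ W A Q S piA tau) :
    CellLimits (probFilter μ) (fun x : Σ n, Ω n => x.1)
      (fun x => observe S (W x.1 x.2) (A x.1 x.2)) (pS Q S) piA (piD Q S)
      (armMoment Q S) (gammaS Q S) (lateS Q S) where
  size_pos := eventually_probFilter_of_atTop (eventually_gt_atTop 0)
  tendsto d a s _ hk := tendsto_cellMoment hS h1 h3 d a s hk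
  p_pos := h1.strata_pos
  q_pos := h3.target_mem.1
  q_lt := h3.target_mem.2
  f_lt s := sub_pos.1 (h1.compliers s)
  moment_zero_true a s := armMoment_zero true a s
  moment_zero_false a s := armMoment_zero_false a (h1.strata_pos s)
  moment_one a s :=
    armMoment_one_add hS h1.sq_integrable h1.no_defiers a (h1.strata_pos s)

end CellAverages

/-- The estimator is organised by arm and the target by source of variation. Grouping `VsatY1` with
`VsatD1` and `VsatY0` with `VsatD0` makes them match term by term. -/
theorem CellLimits.tendsto_Vhat2s {𝒵 𝒮 α : Type*} [MeasurableSpace 𝒵] [Fintype 𝒮]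
    [DecidableEq 𝒮] [MeasurableSpace 𝒮] [MeasurableSingletonClass 𝒮] [Nonempty 𝒮] {S : 𝒵 → 𝒮}
    (hS : Measurable S) {Q : Measure (Participant 𝒵)} [IsProbabilityMeasure Q]
    (hY : ∀ d, MemLp (fun w : Participant 𝒵 => w.Y d) 2 Q) (hdef : Q Participant.DEF = 0)
    {l : Filter α} {N : α → ℕ} {x : ∀ ω, ObsData (N ω) 𝒮} {piA : ℝ}
    (H : CellLimits l N x (pS Q S) piA (piD Q S) (armMoment Q S) (gammaS Q S) (lateS Q S))
    (tau : 𝒮 → ℝ) {r : α → 𝒮 → ℝ} (hr : ∀ s, Tendsto (fun ω => r ω s) l (𝓝 (pS Q S s))) :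
    Tendsto (fun ω => (x ω).Vhat2s tau (r ω)) l (𝓝 (V2s Q S piA tau)) := by
  have hP : ∑ s, pS Q S s * (piD Q S true s - piD Q S false s) = probC Q S := rfl
  have hPne : probC Q S ≠ 0 := H.sum_pos.ne'
  have hβ := sum_lateS_eq_late hS hY hdef hPne
  refine tendsto_nhds_of_eq ((((H.tendsto_Vhat1 hP hβ).add (H.tendsto_Vhat0 hP hβ)).add
    (H.tendsto_VhatH hP hβ)).add (H.tendsto_VhatA2s hP hβ tau hr)) ?_
  rw [V2s, VA2s]
  congr 1
  -- Division by `piD Q S true s` is legitimate, since this exceeds the nonnegative `piD Q S false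
  -- s`. Likewise `piD Q S false s < 1` in `h0`.
  have h1 : ∀ s, _ := fun s => treated_arm_variance_identity
    (v1A := condVariance Q S true Participant.AT s) (v1C := condVariance Q S true Participant.C s)
    (v0N := condVariance Q S false Participant.NT s) (δ := lateS Q S s - late Q) (p := pS Q S s)
    (p1 := piD Q S true s)
    ((measureReal_nonneg.trans_lt (H.f_lt s)).ne') H.q_pos.ne'
    (rfl : gammaS Q S s = _)
  have h0 : ∀ s, _ := fun s => control_arm_variance_identity
    (v1A := condVariance Q S true Participant.AT s) (v0C := condVariance Q S false Participant.C s)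
    (v0N := condVariance Q S false Participant.NT s) (δ := lateS Q S s - late Q) (p := pS Q S s)
    (p0 := piD Q S false s)
    ((sub_pos.2 ((H.f_lt s).trans_le measureReal_le_one)).ne') (sub_pos.2 H.q_lt).ne'
    (rfl : gammaS Q S s = _)
  have hsum1 : VsatY1 Q S (fun _ => piA) + VsatD1 Q S (fun _ => piA) = _ :=
    (mul_add _ _ _).symm.trans (congrArg _ (Finset.sum_add_distrib.symm.trans
      (Finset.sum_congr rfl fun s _ => (h1 s).symm)))
  have hsum0 : VsatY0 Q S (fun _ => piA) + VsatD0 Q S (fun _ => piA) = _ :=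
    (mul_add _ _ _).symm.trans (congrArg _ (Finset.sum_add_distrib.symm.trans
      (Finset.sum_congr rfl fun s _ => (h0 s).symm)))
  have hVsat : Vsat Q S (fun _ => piA)
      = (VsatY1 Q S (fun _ => piA) + VsatD1 Q S (fun _ => piA))
        + (VsatY0 Q S (fun _ => piA) + VsatD0 Q S (fun _ => piA)) + VsatH Q S := by
    rw [Vsat]
    ring
  rw [hVsat, hsum1, hsum0, VsatH]
  congr 2
  · congr 1
    refine Finset.sum_congr rfl fun s _ => ?_
    rw [armMoment_true_true hY s le_rfl, armMoment_true_true hY s (by simp),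
      armMoment_false_true hdef, armMoment_false_true hdef]
    simp only [pow_one]
    rw [setIntegral_Y_sq_eq hS Participant.measurableSet_C (hY true),
      setIntegral_Y_sq_eq hS Participant.measurableSet_AT (hY true),
      setIntegral_Y_sq_eq hS Participant.measurableSet_NT (hY false),
      setIntegral_Y_eq hS Participant.measurableSet_C,
      setIntegral_Y_eq hS Participant.measurableSet_AT,
      setIntegral_Y_eq hS Participant.measurableSet_NT,
      real_AT hdef, real_C hdef, real_NT hdef (H.p_pos s), ← lateS_eq hY]
  · congr 1
    refine Finset.sum_congr rfl fun s _ => ?_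
    rw [armMoment_false_false hY s le_rfl, armMoment_false_false hY s (by simp),
      armMoment_true_false hdef, armMoment_true_false hdef]
    simp only [pow_one]
    rw [setIntegral_Y_sq_eq hS Participant.measurableSet_C (hY false),
      setIntegral_Y_sq_eq hS Participant.measurableSet_AT (hY true),
      setIntegral_Y_sq_eq hS Participant.measurableSet_NT (hY false),
      setIntegral_Y_eq hS Participant.measurableSet_C,
      setIntegral_Y_eq hS Participant.measurableSet_AT,
      setIntegral_Y_eq hS Participant.measurableSet_NT,
      real_AT hdef, real_C hdef, real_NT hdef (H.p_pos s), ← lateS_eq hY]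

end

theorem mainTheorem8 {𝒵 𝒮 : Type*} [MeasurableSpace 𝒵]
    [Fintype 𝒮] [DecidableEq 𝒮] [MeasurableSpace 𝒮] [MeasurableSingletonClass 𝒮]
    (S : 𝒵 → 𝒮) (hS : Measurable S)
    (Q : Measure (Participant 𝒵)) [IsProbabilityMeasure Q]
    {Ω : ℕ → Type*} [∀ n, MeasurableSpace (Ω n)]
    (μ : ∀ n, Measure (Ω n)) [∀ n, IsProbabilityMeasure (μ n)]
    (W : ∀ n, Ω n → Fin n → Participant 𝒵) (A : ∀ n, Ω n → Fin n → Bool)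
    (piA : ℝ) (tau : 𝒮 → ℝ)
    (h1 : SamplingAssumption μ W Q S)
    (h3 : AssignmentAssumption μ W A Q S piA tau) :
    TendstoInProb μ
        (fun n ω => (observe S (W n ω) (A n ω)).Vhat2s tau (pS Q S))
        (V2s Q S piA tau) ∧
      TendstoInProb μ
        (fun n ω => (observe S (W n ω) (A n ω)).Vhat2s tau
          (fun s => (observe S (W n ω) (A n ω)).nS s / n))
        (V2s Q S piA tau) := by
  -- A population has at least one stratum; without one the sum defining `probC` would be empty and
  -- equal to zero.
  obtain ⟨w⟩ := nonempty_of_isProbabilityMeasure Q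
  have : Nonempty 𝒮 := ⟨S w.Z⟩
  have H := cellLimits_observe hS h1 h3
  exact ⟨tendstoInProb_iff.2 (H.tendsto_Vhat2s hS h1.sq_integrable h1.no_defiers tau
      (r := fun _ => pS Q S) fun s => tendsto_const_nhds),
    tendstoInProb_iff.2 (H.tendsto_Vhat2s hS h1.sq_integrable h1.no_defiers tau
      (r := fun x s => (observe S (W x.1 x.2) (A x.1 x.2)).nS s / x.1) H.tendsto_nS)⟩
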